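/- Let $G$ be a locally compact (Hausdorff) group with a fixed left Haar measure $ds$ and modular function $\Delta$, let $1<p<\infty$, and let $q$ be the conjugate exponent, $\frac1p+\frac1q=1$. For $f\in L^1(G)$ and $r\in\{p,q\}$ let $\lambda_r(f)\in B(L^r(G))$ be the convolution operator $\lambda_r(f)g=f*g=\int_G f(s)\,g(s^{-1}\,\cdot\,)\,ds$. Let $PF_p^*(G)$ be the Banach $*$-algebra obtained by completing $L^1(G)$, with convolution as product and the involution $f^*(s)=\Delta(s^{-1})\overline{f(s^{-1})}$, in the norm $$\|f\|_{PF_p^*(G)}=\max\{\|\lambda_p(f)\|_{B(L^p(G))},\ \|\lambda_q(f)\|_{B(L^q(G))}\}.$$ Then the following are equivalent. (i) $G$ is amenable, i.e. there is a left-invariant mean on $L^\infty(G)$. (ii) The trivial representation $1_G:G\to\mathbb C$ extends to a $*$-representation of $PF_p^*(G)$, i.e. there is a $*$-homomorphism $\pi:PF_p^*(G)\to\mathbb C=B(\mathbb C)$ with $\pi(f)=\int_G f(s)\,ds$ for every $f\in L^1(G)$. -/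

import Mathlib

open MeasureTheory Measure Set Filter Topology
open scoped ENNReal NNReal ComplexConjugate

set_option linter.unusedSectionVars false
namespace PseudoFun

section Density
variable {X : Type*} [TopologicalSpace X] [T2Space X] [MeasurableSpace X]
  [BorelSpace X]

theorem regular_withDensity (μ : Measure X) [μ.Regular] {c : X → ℝ≥0} (hc : Continuous c)
    (hpos : ∀ x, c x ≠ 0) : (μ.withDensity fun x => (c x : ℝ≥0∞)).Regular := by
  have hci : Continuous (fun x => (c x)⁻¹ : X → ℝ≥0) := hc.inv₀ hpos
  set s : ℕ → Set X := fun n => {x | c x < (n : ℝ≥0) + 1 ∧ (c x)⁻¹ < (n : ℝ≥0) + 1} with hs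
  have hso : ∀ n, IsOpen (s n) := fun n =>
    (isOpen_lt hc continuous_const).inter (isOpen_lt (f := fun x => (c x)⁻¹) hci continuous_const)
  have hmono : Monotone s := by
    intro m n hmn x hx
    have : (m : ℝ≥0) + 1 ≤ n + 1 := by gcongr
    exact ⟨hx.1.trans_le this, hx.2.trans_le this⟩
  have hcov : ⋃ n, s n = univ := by
    refine eq_univ_of_forall fun x => mem_iUnion.2 ?_
    obtain ⟨n, hn⟩ := exists_nat_gt (max (c x) (c x)⁻¹)
    refine ⟨n, ?_, ?_⟩
    · exact (le_max_left _ _).trans_lt (hn.trans (lt_add_one _))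
    · exact (le_max_right _ _).trans_lt (hn.trans (lt_add_one _))
  have hcm : Measurable fun x => (c x : ℝ≥0∞) := hc.measurable.coe_nnreal_ennreal
  have hupper : ∀ n (A : Set X), MeasurableSet A → A ⊆ s n →
      μ.withDensity (fun x => (c x : ℝ≥0∞)) A ≤ (n + 1 : ℝ≥0∞) * μ A := by
    intro n A hA hAs
    rw [withDensity_apply _ hA]
    calc ∫⁻ x in A, (c x : ℝ≥0∞) ∂μ ≤ ∫⁻ x in A, (n + 1 : ℝ≥0∞) ∂μ := by
          refine setLIntegral_mono' hA fun x hx => ?_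
          exact_mod_cast (hAs hx).1.le
      _ = _ := by simp
  have hlower : ∀ n (A : Set X), MeasurableSet A → A ⊆ s n →
      μ A ≤ (n + 1 : ℝ≥0∞) * μ.withDensity (fun x => (c x : ℝ≥0∞)) A := by
    intro n A hA hAs
    rw [withDensity_apply _ hA, ← lintegral_const_mul _ hcm]
    calc μ A = ∫⁻ x in A, 1 ∂μ := by simp
      _ ≤ _ := by
          refine setLIntegral_mono' hA fun x hx => ?_
          have h1 := (hAs hx).2.le
          have : (1 : ℝ≥0) ≤ (n + 1) * c x := by
            calc (1 : ℝ≥0) = (c x)⁻¹ * c x := (inv_mul_cancel₀ (hpos x)).symm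
              _ ≤ _ := by gcongr
          exact_mod_cast this
  have hK : IsFiniteMeasureOnCompacts (μ.withDensity fun x => (c x : ℝ≥0∞)) := by
    refine ⟨fun K hK => ?_⟩
    obtain ⟨M, hM⟩ := hK.bddAbove_image hc.continuousOn
    rw [withDensity_apply _ hK.measurableSet]
    refine lt_of_le_of_lt (setLIntegral_mono_ae (g := fun _ => (M : ℝ≥0∞))
      measurable_const.aemeasurable (ae_of_all _ fun x hx => ?_)) ?_
    · exact_mod_cast hM (mem_image_of_mem c hx)
    · simpa using ENNReal.mul_lt_top ENNReal.coe_lt_top hK.measure_lt_top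
  have hO : (μ.withDensity fun x => (c x : ℝ≥0∞)).OuterRegular := by
    refine ⟨fun A hA r hr => ?_⟩
    set ν := μ.withDensity fun x => (c x : ℝ≥0∞) with hν
    have hA' : ν A ≠ ∞ := hr.ne_top
    obtain ⟨ε, hε, hsum⟩ := ENNReal.exists_pos_sum_of_countable (tsub_pos_of_lt hr).ne' ℕ
    have key : ∀ n, ∃ U, A ∩ disjointed s n ⊆ U ∧ IsOpen U ∧
        ν U ≤ ν (A ∩ disjointed s n) + ε n := by
      intro n
      have hBm : MeasurableSet (A ∩ disjointed s n) :=
        hA.inter (MeasurableSet.disjointed (fun n => (hso n).measurableSet) n)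
      have hBs : A ∩ disjointed s n ⊆ s n := inter_subset_right.trans (disjointed_subset s n)
      have hBf : μ (A ∩ disjointed s n) ≠ ∞ := by
        refine ne_top_of_le_ne_top (ENNReal.mul_ne_top (by finiteness) ?_) (hlower n _ hBm hBs)
        exact ne_top_of_le_ne_top hA' (measure_mono inter_subset_left)
      have hδ : (ε n : ℝ≥0∞) / (n + 1) ≠ 0 := by
        simpa [ENNReal.div_eq_zero_iff] using (hε n).ne'
      obtain ⟨U, hBU, hU, -, hUB⟩ := hBm.exists_isOpen_sdiff_lt hBf hδ
      refine ⟨U ∩ s n, subset_inter hBU hBs, hU.inter (hso n), ?_⟩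
      have hsub : U ∩ s n ⊆ (A ∩ disjointed s n) ∪ ((U ∩ s n) \ (A ∩ disjointed s n)) := by
        intro x hx
        by_cases h : x ∈ A ∩ disjointed s n
        · exact Or.inl h
        · exact Or.inr ⟨hx, h⟩
      refine (measure_mono hsub).trans ((measure_union_le _ _).trans ?_)
      gcongr
      refine (hupper n _ ((hU.inter (hso n)).measurableSet.diff hBm)
        (sdiff_subset.trans inter_subset_right)).trans ?_
      calc (n + 1 : ℝ≥0∞) * μ ((U ∩ s n) \ (A ∩ disjointed s n))
          ≤ (n + 1 : ℝ≥0∞) * (ε n / (n + 1)) := by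
            gcongr
            exact (measure_mono (sdiff_subset_sdiff_left inter_subset_left)).trans hUB.le
        _ = ε n := ENNReal.mul_div_cancel (by simp) (by finiteness)
    choose U hU hUo hUν using key
    have hAeq : A = ⋃ n, A ∩ disjointed s n := by
      rw [← inter_iUnion, iUnion_disjointed, hcov, inter_univ]
    refine ⟨⋃ n, U n, ?_, isOpen_iUnion hUo, ?_⟩
    · rw [hAeq]
      exact iUnion_mono hU
    · have hAs : ∑' n, ν (A ∩ disjointed s n) = ν A := by
        rw [← measure_iUnion, ← hAeq]
        · intro i j hij
          exact ((disjoint_disjointed s) hij).mono inter_subset_right inter_subset_right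
        · exact fun n => hA.inter (MeasurableSet.disjointed (fun n => (hso n).measurableSet) n)
      calc ν (⋃ n, U n) ≤ ∑' n, ν (U n) := measure_iUnion_le _
        _ ≤ ∑' n, (ν (A ∩ disjointed s n) + ε n) := ENNReal.tsum_le_tsum hUν
        _ = ν A + ∑' n, (ε n : ℝ≥0∞) := by rw [ENNReal.tsum_add, hAs]
        _ < ν A + (r - ν A) := (ENNReal.add_lt_add_iff_left hA').2 hsum
        _ = r := add_tsub_cancel_of_le hr.le
  refine { toIsFiniteMeasureOnCompacts := hK, toOuterRegular := hO, innerRegular := ?_ }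
  intro U hU r hr
  set ν := μ.withDensity fun x => (c x : ℝ≥0∞) with hν
  have hUeq : U = ⋃ n, U ∩ s n := by rw [← inter_iUnion, hcov, inter_univ]
  rw [hUeq, Monotone.measure_iUnion
    (fun m n hmn => inter_subset_inter_right _ (hmono hmn)), lt_iSup_iff] at hr
  obtain ⟨n, hn⟩ := hr
  have hVo : IsOpen (U ∩ s n) := hU.inter (hso n)
  by_cases hV : μ (U ∩ s n) = ∞
  · obtain ⟨K, hKV, hKc, hKμ⟩ := hVo.exists_lt_isCompact
      (μ := μ) (r := (n + 1 : ℝ≥0∞) * r) (by rw [hV]; exact ENNReal.mul_lt_top (by finiteness) hn.lt_top)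
    refine ⟨K, hKV.trans inter_subset_left, hKc, ?_⟩
    have := hKμ.trans_le (hlower n K hKc.measurableSet (hKV.trans inter_subset_right))
    exact lt_of_mul_lt_mul_left' this
  · have hνV : ν (U ∩ s n) ≠ ∞ := ne_top_of_le_ne_top (ENNReal.mul_ne_top (by finiteness) hV)
      (hupper n _ hVo.measurableSet inter_subset_right)
    have hδ : (ν (U ∩ s n) - r) / (n + 1) ≠ 0 := 
      ENNReal.div_ne_zero.2 ⟨(tsub_pos_of_lt hn).ne', by finiteness⟩
    obtain ⟨K, hKV, hKc, hKμ⟩ := hVo.measurableSet.exists_isCompact_sdiff_lt hV hδ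
    refine ⟨K, hKV.trans inter_subset_left, hKc, ?_⟩
    by_contra hcon
    have h1 : ν ((U ∩ s n) \ K) < ν (U ∩ s n) - r := by
      refine (hupper n _ (hVo.measurableSet.diff hKc.measurableSet)
        (sdiff_subset.trans inter_subset_right)).trans_lt ?_
      rw [← ENNReal.mul_div_cancel (a := (n + 1 : ℝ≥0∞)) (b := ν (U ∩ s n) - r)
        (by simp) (by finiteness)]
      exact ENNReal.mul_lt_mul_right (by simp) (by finiteness) hKμ
    have h2 : ν (U ∩ s n) ≤ ν K + ν ((U ∩ s n) \ K) := by
      refine (measure_mono ?_).trans (measure_union_le _ _)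
      rw [union_sdiff_self]
      exact subset_union_right
    have h3 : ν (U ∩ s n) < r + (ν (U ∩ s n) - r) :=
      h2.trans_lt (ENNReal.add_lt_add_of_le_of_lt (ne_top_of_le_ne_top hn.ne_top (not_lt.1 hcon))
        (not_lt.1 hcon) h1)
    rw [add_tsub_cancel_of_le hn.le] at h3
    exact lt_irrefl _ h3
end Density

section Modular
variable {G : Type*} [Group G] [TopologicalSpace G] [IsTopologicalGroup G]
  [LocallyCompactSpace G] [T2Space G] [MeasurableSpace G] [BorelSpace G]
variable (μ : Measure G) [μ.IsHaarMeasure] [μ.Regular]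

theorem continuous_modularCharacterFun : Continuous (modularCharacterFun : G → ℝ≥0) := by
  obtain ⟨⟨f, f_cont⟩, f_comp, f_nonneg, f_one⟩ :
    ∃ f : C(G, ℝ), HasCompactSupport f ∧ 0 ≤ f ∧ f 1 ≠ 0 := exists_continuous_nonneg_pos 1
  let μ : Measure G := haar
  have hne : ∫ x, f x ∂μ ≠ 0 :=
    ne_of_gt (f_cont.integral_pos_of_hasCompactSupport_nonneg_nonzero f_comp f_nonneg f_one)
  have key : ∀ g : G, (modularCharacterFun g : ℝ) = (∫ x, f (x⁻¹ * g) ∂μ.inv) / ∫ x, f x ∂μ := by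
    intro g
    rw [modularCharacterFun_eq_haarScalarFactor μ g,
      haarScalarFactor_eq_integral_div _ _ f_cont f_comp hne]
    congr 1
    have h1 : ∫ x, f x ∂(map (· * g) μ) = ∫ x, f (x * g) ∂μ :=
      (Homeomorph.mulRight g).measurableEmbedding.integral_map f
    have h2 : ∫ x, f (x⁻¹ * g) ∂μ.inv = ∫ x, f (x⁻¹⁻¹ * g) ∂μ :=
      (MeasurableEquiv.inv G).measurableEmbedding.integral_map fun x => f (x⁻¹ * g)
    rw [h1, h2]
    simp
  rw [NNReal.isEmbedding_coe.continuous_iff]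
  have : (NNReal.toReal ∘ (modularCharacterFun : G → ℝ≥0)) =
      fun g => (∫ x, f (x⁻¹ * g) ∂μ.inv) / ∫ x, f x ∂μ := funext key
  rw [this]
  exact (continuous_integral_apply_inv_mul f_cont f_comp).div_const _

theorem map_mul_right_eq (g : G) : map (· * g) μ = modularCharacterFun g • μ := by
  rw [modularCharacterFun_eq_haarScalarFactor μ g]
  have : (map (· * g) μ).Regular := Regular.map (Homeomorph.mulRight g)
  exact isMulLeftInvariant_eq_smul_of_regular _ μ

theorem inv_withDensity_modular :
    (μ.withDensity fun x => (modularCharacterFun x : ℝ≥0∞)).inv = μ := by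
  have hc := continuous_modularCharacterFun (G := G)
  have hcm : Measurable fun x : G => (modularCharacterFun x : ℝ≥0∞) :=
    hc.measurable.coe_nnreal_ennreal
  have : (μ.withDensity fun x => (modularCharacterFun x : ℝ≥0∞)).Regular :=
    regular_withDensity μ hc fun x => (modularCharacterFun_pos x).ne'
  set ρ := μ.withDensity fun x => (modularCharacterFun x : ℝ≥0∞) with hρ
  have : ρ.IsMulRightInvariant := by
    refine ⟨fun g => ?_⟩
    have hg : modularCharacterFun g ≠ 0 := (modularCharacterFun_pos g).ne'
    ext A hA
    have hind : Measurable (A.indicator fun x : G => (modularCharacterFun x : ℝ≥0∞)) :=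
      hcm.indicator hA
    have hpre : MeasurableSet ((· * g) ⁻¹' A) := measurable_mul_const g hA
    rw [map_apply (measurable_mul_const g) hA, hρ, withDensity_apply _ hA,
      withDensity_apply _ hpre, ← lintegral_indicator hA, ← lintegral_indicator hpre]
    have h1 := congrArg (fun m => ∫⁻ x, A.indicator
      (fun x : G => (modularCharacterFun x : ℝ≥0∞)) x ∂m) (map_mul_right_eq μ g)
    rw [lintegral_map hind (measurable_mul_const g), lintegral_smul_measure] at h1
    have h2 : ∀ x, A.indicator (fun x : G => (modularCharacterFun x : ℝ≥0∞)) (x * g) =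
        modularCharacterFun g * ((· * g) ⁻¹' A).indicator
          (fun x : G => (modularCharacterFun x : ℝ≥0∞)) x := by
      intro x
      by_cases hx : x * g ∈ A
      · rw [indicator_of_mem hx, indicator_of_mem (show x ∈ (· * g) ⁻¹' A from hx),
          modularCharacterFun_map_mul]
        push_cast
        ring
      · rw [indicator_of_notMem hx, indicator_of_notMem (show x ∉ (· * g) ⁻¹' A from hx), mul_zero]
    simp_rw [h2] at h1
    rw [lintegral_const_mul _ (hcm.indicator hpre), ENNReal.smul_def, smul_eq_mul] at h1
    exact (ENNReal.mul_right_inj (by exact_mod_cast hg) (by finiteness)).1 h1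
  set c := haarScalarFactor ρ.inv μ with hcdef
  have h1 : ρ.inv = c • μ := isMulLeftInvariant_eq_smul_of_regular _ μ
  have hF : ∀ F : G → ℝ≥0∞, Measurable F →
      ∫⁻ x, modularCharacterFun x * F x⁻¹ ∂μ = c * ∫⁻ x, F x ∂μ := by
    intro F hF
    have h2 := congrArg (fun m => ∫⁻ x, F x ∂m) h1
    rw [lintegral_smul_measure, Measure.inv, lintegral_map hF measurable_inv, hρ,
      lintegral_withDensity_eq_lintegral_mul _ hcm (g := fun x => F x⁻¹)
        (hF.comp measurable_inv)] at h2
    exact h2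
  have h3 : c = 1 := by
    obtain ⟨K, hK, hK1⟩ := exists_compact_mem_nhds (1 : G)
    have hKm := hK.measurableSet
    set F : G → ℝ≥0∞ := K.indicator 1 with hFdef
    have hFm : Measurable F := measurable_one.indicator hKm
    have e1 := hF F hFm
    have e2 := hF (fun x => modularCharacterFun x * F x⁻¹) (hcm.mul (hFm.comp measurable_inv))
    have e3 : ∀ x : G, (modularCharacterFun x : ℝ≥0∞) * (modularCharacterFun x⁻¹ * F x⁻¹⁻¹) =
        F x := by
      intro x
      have : modularCharacterFun x * modularCharacterFun x⁻¹ = 1 := by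
        rw [← modularCharacterFun_map_mul, mul_inv_cancel, modularCharacterFun_map_one]
      rw [← mul_assoc, ← ENNReal.coe_mul, this, inv_inv, ENNReal.coe_one, one_mul]
    simp_rw [e3] at e2
    rw [e1, ← mul_assoc] at e2
    have hFK : ∫⁻ x, F x ∂μ = μ K := lintegral_indicator_one hKm
    rw [hFK] at e2
    have hpos : μ K ≠ 0 := (measure_pos_of_mem_nhds μ hK1).ne'
    have h4 : (1 : ℝ≥0∞) * μ K = ((c * c : ℝ≥0) : ℝ≥0∞) * μ K := by
      rw [one_mul, ENNReal.coe_mul]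
      exact e2
    have h5 := (ENNReal.mul_left_inj hpos hK.measure_lt_top.ne).1 h4
    have h6 : c * c = 1 := by exact_mod_cast h5.symm
    exact (pow_eq_one_iff_of_nonneg zero_le two_ne_zero).1 (by rw [pow_two, h6])
  rw [h1, h3, one_smul]

theorem inv_eq_withDensity_modular :
    μ.inv = μ.withDensity fun x => (modularCharacterFun x : ℝ≥0∞) := by
  conv_lhs => rw [← inv_withDensity_modular μ]
  exact Measure.inv_inv _

theorem quasiMeasurePreserving_inv : QuasiMeasurePreserving (Inv.inv : G → G) μ μ := by
  refine ⟨measurable_inv, ?_⟩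
  have h : map Inv.inv μ = μ.inv := rfl
  rw [h, inv_eq_withDensity_modular μ]
  exact withDensity_absolutelyContinuous _ _

theorem integral_modular_smul_inv {E : Type*} [NormedAddCommGroup E] [NormedSpace ℝ E]
    (F : G → E) : ∫ x, modularCharacterFun x • F x⁻¹ ∂μ = ∫ x, F x ∂μ := by
  rw [← integral_withDensity_eq_integral_smul continuous_modularCharacterFun.measurable
    fun x => F x⁻¹, ← inv_eq_withDensity_modular μ]
  have := (MeasurableEquiv.inv G).measurableEmbedding.integral_map (μ := μ) fun x => F x⁻¹
  simp only [MeasurableEquiv.inv_apply, inv_inv] at this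
  exact this

theorem integrable_modular_smul_inv {E : Type*} [NormedAddCommGroup E] [NormedSpace ℝ E]
    {F : G → E} (hF : Integrable F μ) :
    Integrable (fun x => modularCharacterFun x • F x⁻¹) μ := by
  rw [← integrable_withDensity_iff_integrable_smul continuous_modularCharacterFun.measurable
    (g := fun x => F x⁻¹), ← inv_eq_withDensity_modular μ]
  have h := integrable_map_equiv (μ := μ) (MeasurableEquiv.inv G) fun x => F x⁻¹
  refine h.2 ?_
  simpa [Function.comp_def] using hF

end Modular

section Convolution
variable {G : Type*} [Group G] [TopologicalSpace G] [IsTopologicalGroup G]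
  [LocallyCompactSpace G] [T2Space G] [MeasurableSpace G] [BorelSpace G]
variable (μ : Measure G) [μ.IsHaarMeasure] [μ.Regular]

/-- Left translation `(L_s g)(t) = g (s⁻¹ * t)` on `L^p(G)`. -/
noncomputable def leftTranslate {E : Type*} [NormedAddCommGroup E] {p : ℝ≥0∞} (s : G)
    (g : Lp E p μ) : Lp E p μ :=
  DomMulAct.mk s⁻¹ • g

theorem leftTranslate_ae_eq {E : Type*} [NormedAddCommGroup E] {p : ℝ≥0∞} (s : G)
    (g : Lp E p μ) : leftTranslate μ s g =ᵐ[μ] fun t => g (s⁻¹ * t) :=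
  DomMulAct.smul_Lp_ae_eq _ _

theorem aestronglyMeasurable_smul {E : Type*} [NormedAddCommGroup E] [NormedSpace ℂ E]
    {f : G → ℂ} (hf : Integrable f μ) {F : G → E} (hF : Continuous F) :
    AEStronglyMeasurable (fun s => f s • F s) μ := by
  have hf1 : MemLp f 1 μ := memLp_one_iff_integrable.2 hf
  have : ∀ n : ℕ, ∃ g : G → ℂ, eLpNorm (g - f) 1 μ ≤ ENNReal.ofReal ((1 / 2 : ℝ) ^ n) ∧
      AEStronglyMeasurable g μ ∧ AEStronglyMeasurable (fun s => g s • F s) μ := by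
    intro n
    simp_rw [eLpNorm_sub_comm _ f]
    refine hf1.induction_dense (by simp)
      (fun g => AEStronglyMeasurable g μ ∧ AEStronglyMeasurable (fun s => g s • F s) μ)
      ?_ ?_ (fun g hg => hg.1)
      (ENNReal.ofReal_pos.2 (pow_pos (by norm_num : (0 : ℝ) < 1 / 2) n)).ne'
    · intro c t ht htμ ε hε
      obtain ⟨η, ηpos, hη⟩ :
          ∃ η : ℝ≥0, 0 < η ∧ ∀ s : Set G, μ s ≤ η → eLpNorm (s.indicator fun _ => c) 1 μ ≤ ε :=
        exists_eLpNorm_indicator_le (by simp) c hε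
      have hη0 : (η : ℝ≥0∞) ≠ 0 := by exact_mod_cast ηpos.ne'
      obtain ⟨k, kt, hk, hkμ⟩ := ht.exists_isCompact_sdiff_lt htμ.ne hη0
      refine ⟨k.indicator fun _ => c, ?_,
        aestronglyMeasurable_const.indicator hk.measurableSet, ?_⟩
      · rw [eLpNorm_sub_comm, ← indicator_sdiff kt]
        exact hη _ hkμ.le
      · have h1 : (fun s => (k.indicator (fun _ => c) s : ℂ) • F s) =
            k.indicator fun s => c • F s := by
          ext s
          by_cases hs : s ∈ k <;> simp [hs]
        rw [h1, aestronglyMeasurable_indicator_iff hk.measurableSet]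
        exact (hF.const_smul c).continuousOn.aestronglyMeasurable_of_isCompact hk hk.measurableSet
    · rintro g g' ⟨h1, h2⟩ ⟨h3, h4⟩
      refine ⟨h1.add h3, ?_⟩
      simp only [Pi.add_apply, add_smul]
      exact h2.add h4
  choose g hgn hgm hgF using this
  have ht : TendstoInMeasure μ g atTop f := by
    refine tendstoInMeasure_of_tendsto_eLpNorm one_ne_zero hgm hf1.1 ?_
    refine tendsto_of_tendsto_of_tendsto_of_le_of_le tendsto_const_nhds ?_ (fun _ => zero_le)
      hgn
    rw [← ENNReal.ofReal_zero]
    exact ENNReal.tendsto_ofReal (tendsto_pow_atTop_nhds_zero_of_lt_one (by norm_num) (by norm_num))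
  obtain ⟨ns, -, hns⟩ := ht.exists_seq_tendsto_ae
  refine aestronglyMeasurable_of_tendsto_ae atTop (f := fun n s => g (ns n) s • F s)
    (fun n => hgF (ns n)) (hns.mono fun s hs => hs.smul_const (F s))

variable (p : ℝ≥0∞) [Fact (1 ≤ p)] [Fact (p ≠ ∞)]

theorem continuous_leftTranslate (g : Lp ℂ p μ) : Continuous fun s => leftTranslate μ s g := by
  unfold leftTranslate
  have h : Continuous fun s : G => DomMulAct.mk s⁻¹ :=
    DomMulAct.continuous_mk.comp continuous_inv
  exact h.smul continuous_const

theorem integrable_smul_leftTranslate (f : Lp ℂ 1 μ) (g : Lp ℂ p μ) :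
    Integrable (fun s => f s • leftTranslate μ s g) μ := by
  have hf := L1.integrable_coeFn f
  refine Integrable.mono' (hf.norm.mul_const ‖g‖)
    (aestronglyMeasurable_smul μ hf (continuous_leftTranslate μ p g)) (ae_of_all _ fun s => ?_)
  rw [norm_smul, leftTranslate, DomMulAct.norm_smul_Lp]

/-- The left regular representation `λ_p(f) g = f * g` of `L¹(G)` on `L^p(G)`, `1 ≤ p < ∞`.  The
convolution `f * g = ∫ f(s) L_s g ds`, i.e. `(f * g)(t) = ∫ f(s) g(s⁻¹ t) ds`, is taken as a
Bochner integral in `L^p(G)`. -/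
noncomputable def lam : Lp ℂ 1 μ →L[ℂ] Lp ℂ p μ →L[ℂ] Lp ℂ p μ :=
  LinearMap.mkContinuous₂
    (LinearMap.mk₂ ℂ (fun (f : Lp ℂ 1 μ) (g : Lp ℂ p μ) => ∫ s, f s • leftTranslate μ s g ∂μ)
      (by
        intro f f' g
        rw [← integral_add (integrable_smul_leftTranslate μ p f g)
          (integrable_smul_leftTranslate μ p f' g)]
        refine integral_congr_ae ?_
        filter_upwards [Lp.coeFn_add f f'] with s hs
        rw [hs, Pi.add_apply, add_smul])
      (by
        intro c f g
        rw [← integral_smul]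
        refine integral_congr_ae ?_
        filter_upwards [Lp.coeFn_smul c f] with s hs
        rw [hs, Pi.smul_apply, smul_assoc])
      (by
        intro f g g'
        rw [← integral_add (integrable_smul_leftTranslate μ p f g)
          (integrable_smul_leftTranslate μ p f g')]
        refine integral_congr_ae (ae_of_all _ fun s => ?_)
        simp only [leftTranslate, smul_add])
      (by
        intro c f g
        rw [← integral_smul]
        refine integral_congr_ae (ae_of_all _ fun s => ?_)
        simp only [leftTranslate]
        rw [smul_comm _ c g, smul_comm]))
    1
    (by
      intro f g
      rw [one_mul, L1.norm_eq_integral_norm, ← integral_mul_const]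
      refine norm_integral_le_of_norm_le ((L1.integrable_coeFn f).norm.mul_const _)
        (ae_of_all _ fun s => ?_)
      rw [norm_smul, leftTranslate, DomMulAct.norm_smul_Lp])

theorem lam_apply (f : Lp ℂ 1 μ) (g : Lp ℂ p μ) :
    lam μ p f g = ∫ s, f s • leftTranslate μ s g ∂μ := rfl

theorem leftTranslate_lam (s : G) (f : Lp ℂ 1 μ) (g : Lp ℂ p μ) :
    leftTranslate μ s (lam μ p f g) = lam μ p (leftTranslate μ s f) g := by
  have h1 : ∀ x : Lp ℂ p μ, leftTranslate μ s x =
      (Lp.compMeasurePreservingₗᵢ ℂ (s⁻¹ * ·) (measurePreserving_mul_left μ s⁻¹)) x :=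
    fun _ => rfl
  rw [lam_apply, h1, ← LinearIsometry.coe_toContinuousLinearMap,
    ← ContinuousLinearMap.integral_comp_comm _ (integrable_smul_leftTranslate μ p f g), lam_apply]
  rw [← integral_mul_left_eq_self (fun t => leftTranslate μ s f t • leftTranslate μ t g) s]
  have h2 : ∀ᵐ t ∂μ, leftTranslate μ s f (s * t) = f t := by
    have := (measurePreserving_mul_left μ s).quasiMeasurePreserving.ae (leftTranslate_ae_eq μ s f)
    filter_upwards [this] with t ht
    rw [ht, inv_mul_cancel_left]
  refine integral_congr_ae ?_
  filter_upwards [h2] with t ht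
  rw [ht, LinearIsometry.coe_toContinuousLinearMap, map_smul, ← h1]
  congr 1
  simp only [leftTranslate, smul_smul, ← DomMulAct.mk_mul, mul_inv_rev]

instance : Fact ((1 : ℝ≥0∞) ≠ ∞) := ⟨ENNReal.one_ne_top⟩

theorem lam_lam (f g : Lp ℂ 1 μ) (h : Lp ℂ p μ) :
    lam μ p (lam μ 1 f g) h = lam μ p f (lam μ p g h) := by
  rw [lam_apply μ 1, ← ContinuousLinearMap.flip_apply (lam μ p),
    ← ContinuousLinearMap.integral_comp_comm _ (integrable_smul_leftTranslate μ 1 f g),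
    lam_apply μ p f]
  refine integral_congr_ae (ae_of_all _ fun s => ?_)
  simp only [map_smul, ContinuousLinearMap.flip_apply]
  rw [leftTranslate_lam]

/-- The involution `f^*(s) = Δ(s⁻¹) conj (f (s⁻¹))` on `L¹(G)`.  Mathlib's `modularCharacterFun s`
is `μ (A * s⁻¹) / μ A`, i.e. the value `Δ(s⁻¹)` of the modular function normalised by
`μ (A * s) = Δ(s) μ A`. -/
noncomputable def invol (f : Lp ℂ 1 μ) : Lp ℂ 1 μ :=
  (integrable_modular_smul_inv μ
    (Complex.conjLIE.toContinuousLinearEquiv.toContinuousLinearMap.integrable_comp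
      (L1.integrable_coeFn f))).toL1 fun s => modularCharacterFun s • conj (f s⁻¹)

theorem invol_ae_eq (f : Lp ℂ 1 μ) :
    invol μ f =ᵐ[μ] fun s => modularCharacterFun s • conj (f s⁻¹) :=
  Integrable.coeFn_toL1 _

theorem invol_add (f g : Lp ℂ 1 μ) : invol μ (f + g) = invol μ f + invol μ g := by
  refine Lp.ext ?_
  filter_upwards [invol_ae_eq μ (f + g), invol_ae_eq μ f, invol_ae_eq μ g,
    Lp.coeFn_add (invol μ f) (invol μ g),
    (quasiMeasurePreserving_inv μ).ae (Lp.coeFn_add f g)] with s h1 h2 h3 h4 h5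
  rw [h1, h4, Pi.add_apply, h2, h3, h5, Pi.add_apply, map_add, smul_add]

theorem invol_smul (c : ℂ) (f : Lp ℂ 1 μ) : invol μ (c • f) = conj c • invol μ f := by
  refine Lp.ext ?_
  filter_upwards [invol_ae_eq μ (c • f), invol_ae_eq μ f,
    Lp.coeFn_smul (conj c) (invol μ f),
    (quasiMeasurePreserving_inv μ).ae (Lp.coeFn_smul c f)] with s h1 h2 h4 h5
  rw [h1, h4, Pi.smul_apply, h2, h5, Pi.smul_apply, smul_eq_mul, map_mul, smul_eq_mul,
    mul_smul_comm]

theorem invol_invol (f : Lp ℂ 1 μ) : invol μ (invol μ f) = f := by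
  refine Lp.ext ?_
  filter_upwards [invol_ae_eq μ (invol μ f),
    (quasiMeasurePreserving_inv μ).ae (invol_ae_eq μ f)] with s h1 h2
  have : modularCharacterFun s * modularCharacterFun s⁻¹ = 1 := by
    rw [← modularCharacterFun_map_mul, mul_inv_cancel, modularCharacterFun_map_one]
  rw [h1, h2, inv_inv, NNReal.smul_def, NNReal.smul_def, Complex.real_smul, Complex.real_smul,
    map_mul, Complex.conj_conj, Complex.conj_ofReal, ← mul_assoc, ← Complex.ofReal_mul,
    ← NNReal.coe_mul, this, NNReal.coe_one, Complex.ofReal_one, one_mul]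

variable (q : ℝ≥0∞) [Fact (1 ≤ q)] [Fact (q ≠ ∞)] [p.HolderConjugate q]

/-- The duality pairing `⟨g, h⟩ = ∫ g conj h` of `L^p(G)` and `L^q(G)`, linear in `g`. -/
noncomputable def pairing (h : Lp ℂ q μ) : Lp ℂ p μ →L[ℂ] ℂ :=
  ((ContinuousLinearMap.mul ℂ ℂ).lpPairing μ p q).flip (star h)

theorem pairing_apply (g : Lp ℂ p μ) (h : Lp ℂ q μ) :
    pairing μ p q h g = ∫ t, g t * conj (h t) ∂μ := by
  rw [pairing, ContinuousLinearMap.flip_apply, ContinuousLinearMap.lpPairing_eq_integral]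
  refine integral_congr_ae ?_
  filter_upwards [Lp.coeFn_star h] with t ht
  rw [ht]
  rfl

theorem norm_star_Lp (h : Lp ℂ q μ) : ‖star h‖ = ‖h‖ := by
  rw [Lp.norm_def, Lp.norm_def]
  congr 1
  refine eLpNorm_congr_norm_ae ?_
  filter_upwards [Lp.coeFn_star h] with t ht
  rw [ht, Pi.star_apply, norm_star]

theorem norm_pairing_le (g : Lp ℂ p μ) (h : Lp ℂ q μ) :
    ‖pairing μ p q h g‖ ≤ ‖g‖ * ‖h‖ := by
  have h1 := (ContinuousLinearMap.mul ℂ ℂ).norm_holder_apply_apply_le (r := 1) g (star h)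
  have h2 : pairing μ p q h g =
      L1.integral ((ContinuousLinearMap.mul ℂ ℂ).holder 1 g (star h)) := by
    rw [L1.integral_eq' (𝕜 := ℂ)]
    rfl
  rw [h2]
  refine (L1.norm_integral_le _).trans (h1.trans ?_)
  rw [norm_star_Lp]
  have := ContinuousLinearMap.opNorm_mul_le ℂ ℂ
  have h3 : 0 ≤ ‖g‖ * ‖h‖ := by positivity
  nlinarith

theorem norm_le_of_pairing (g : Lp ℂ p μ) {C : ℝ} (hC0 : 0 ≤ C)
    (hC : ∀ h : Lp ℂ q μ, ‖pairing μ p q h g‖ ≤ C * ‖h‖) : ‖g‖ ≤ C := by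
  by_cases hg0 : g = 0
  · rw [hg0, norm_zero]
    exact hC0
  have hp1 : 1 ≤ p := Fact.out
  have hpt : p ≠ ∞ := Fact.out
  have hqt : q ≠ ∞ := Fact.out
  have hpq : p.HolderConjugate q := inferInstance
  set r := p.toReal with hr
  have hrq : r.HolderConjugate q.toReal := ENNReal.HolderConjugate.toReal_of_ne_top hpt hqt
  have hr1 : 1 < r := hrq.lt
  have hqr : q * ENNReal.ofReal (r - 1) = p := by
    rw [← ENNReal.ofReal_toReal hqt, ← ENNReal.ofReal_mul ENNReal.toReal_nonneg,
      ← ENNReal.ofReal_toReal hpt, ← hr]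
    congr 1
    have := hrq.mul_eq_add
    linarith
  have hpos : 0 < r - 1 := sub_pos.2 hr1
  set k : G → ℂ := fun t => ((‖g t‖ ^ (r - 2) : ℝ) : ℂ) * g t with hk
  have hkn : ∀ t, ‖k t‖ = ‖g t‖ ^ (r - 1) := by
    intro t
    by_cases h0 : g t = 0
    · simp [hk, h0, Real.zero_rpow hpos.ne']
    · have : 0 < ‖g t‖ := norm_pos_iff.2 h0
      rw [hk]
      simp only [norm_mul, Complex.norm_real, Real.norm_eq_abs]
      rw [abs_of_nonneg (by positivity), ← Real.rpow_add_one this.ne']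
      congr 1
      ring
  have hkm : AEStronglyMeasurable k μ := by
    have h1 : AEMeasurable g μ := (Lp.aestronglyMeasurable g).aemeasurable
    exact ((Complex.measurable_ofReal.comp_aemeasurable
      (h1.norm.pow_const (r - 2))).mul h1).aestronglyMeasurable
  have hke : eLpNorm k q μ = eLpNorm g p μ ^ (r - 1) := by
    have h1 := eLpNorm_norm_rpow (p := q) (μ := μ) g hpos
    rw [hqr] at h1
    rw [← h1]
    refine eLpNorm_congr_norm_ae (ae_of_all _ fun t => ?_)
    rw [hkn, Real.norm_eq_abs, abs_of_nonneg (by positivity)]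
  have hkL : MemLp k q μ := by
    refine ⟨hkm, ?_⟩
    rw [hke]
    exact ENNReal.rpow_lt_top_of_nonneg hpos.le (Lp.eLpNorm_ne_top g)
  have hnorm : ‖hkL.toLp k‖ = ‖g‖ ^ (r - 1) := by
    rw [Lp.norm_toLp, hke, ← ENNReal.toReal_rpow, Lp.norm_def]
  have hint : ∫ t, ‖g t‖ ^ r ∂μ = ‖g‖ ^ r := by
    rw [Lp.norm_def, (Lp.memLp g).eLpNorm_eq_integral_rpow_norm
      (zero_lt_one.trans_le hp1).ne' hpt, ENNReal.toReal_ofReal (by positivity), ← hr,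
      ← Real.rpow_mul (by positivity), inv_mul_cancel₀ (by linarith), Real.rpow_one]
  have hpair : pairing μ p q (hkL.toLp k) g = ((‖g‖ ^ r : ℝ) : ℂ) := by
    rw [pairing_apply, ← hint, ← integral_complex_ofReal]
    refine integral_congr_ae ?_
    filter_upwards [hkL.coeFn_toLp] with t ht
    rw [ht, hk]
    simp only [map_mul, Complex.conj_ofReal]
    rw [mul_left_comm, Complex.mul_conj, Complex.normSq_eq_norm_sq, ← Complex.ofReal_mul]
    congr 1
    by_cases h0 : ‖g t‖ = 0
    · rw [h0, Real.zero_rpow (x := r) (by linarith)]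
      simp
    · rw [← Real.rpow_natCast, ← Real.rpow_add (lt_of_le_of_ne (norm_nonneg _) (Ne.symm h0))]
      congr 1
      push_cast
      ring
  have hfin := hC (hkL.toLp k)
  rw [hpair, hnorm, Complex.norm_real, Real.norm_eq_abs, abs_of_nonneg (by positivity)] at hfin
  have hgp : 0 < ‖g‖ := norm_pos_iff.2 hg0
  have : ‖g‖ ^ r = ‖g‖ * ‖g‖ ^ (r - 1) := by
    rw [mul_comm, ← Real.rpow_add_one hgp.ne']
    congr 1
    ring
  rw [this] at hfin
  exact le_of_mul_le_mul_right hfin (by positivity)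

theorem pairing_swap (g : Lp ℂ p μ) (h : Lp ℂ q μ) :
    haveI : q.HolderConjugate p := ENNReal.HolderConjugate.symm
    pairing μ p q h g = conj (pairing μ q p g h) := by
  rw [pairing_apply, pairing_apply, ← integral_conj]
  refine integral_congr_ae (ae_of_all _ fun t => ?_)
  simp [mul_comm]

theorem pairing_leftTranslate (s : G) (g : Lp ℂ p μ) (h : Lp ℂ q μ) :
    pairing μ p q h (leftTranslate μ s⁻¹ g) = pairing μ p q (leftTranslate μ s h) g := by
  rw [pairing_apply, pairing_apply,
    ← integral_mul_left_eq_self (fun t => leftTranslate μ s⁻¹ g t * conj (h t)) s⁻¹]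
  have h1 := (measurePreserving_mul_left μ s⁻¹).quasiMeasurePreserving.ae
    (leftTranslate_ae_eq μ s⁻¹ g)
  refine integral_congr_ae ?_
  filter_upwards [h1, leftTranslate_ae_eq μ s h] with t ht ht'
  rw [ht, ht', inv_inv, mul_inv_cancel_left]

theorem pairing_lam_invol (f : Lp ℂ 1 μ) (g : Lp ℂ p μ) (h : Lp ℂ q μ) :
    pairing μ p q h (lam μ p (invol μ f) g) = pairing μ p q (lam μ q f h) g := by
  have hsymm : q.HolderConjugate p := ENNReal.HolderConjugate.symm
  rw [pairing_swap μ p q g (lam μ q f h), lam_apply, lam_apply,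
    ← ContinuousLinearMap.integral_comp_comm _ (integrable_smul_leftTranslate μ q f h),
    ← ContinuousLinearMap.integral_comp_comm _ (integrable_smul_leftTranslate μ p _ g),
    ← integral_conj, ← integral_modular_smul_inv μ fun s =>
      conj (pairing μ q p g (f s • leftTranslate μ s h))]
  refine integral_congr_ae ?_
  filter_upwards [invol_ae_eq μ f] with s hs
  rw [hs, map_smul, map_smul, smul_eq_mul, smul_eq_mul, map_mul, ← pairing_swap,
    ← pairing_leftTranslate, inv_inv, smul_mul_assoc]

theorem norm_lam_invol_le (f : Lp ℂ 1 μ) : ‖lam μ p (invol μ f)‖ ≤ ‖lam μ q f‖ := by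
  refine ContinuousLinearMap.opNorm_le_bound _ (norm_nonneg _) fun g => ?_
  refine norm_le_of_pairing μ p q _ (by positivity) fun h => ?_
  rw [pairing_lam_invol]
  refine (norm_pairing_le μ p q _ _).trans ?_
  have := (lam μ q f).le_opNorm h
  calc ‖g‖ * ‖lam μ q f h‖ ≤ ‖g‖ * (‖lam μ q f‖ * ‖h‖) := by gcongr
    _ = _ := by ring

theorem lam_invol_lam (q' : ℝ≥0∞) [Fact (1 ≤ q')] [Fact (q' ≠ ∞)] [p.HolderConjugate q']
    (f g : Lp ℂ 1 μ) :
    lam μ p (invol μ (lam μ 1 f g)) = lam μ p (lam μ 1 (invol μ g) (invol μ f)) := by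
  ext1 x
  rw [← sub_eq_zero, ← norm_le_zero_iff]
  refine norm_le_of_pairing μ p q' _ le_rfl fun h => ?_
  rw [map_sub, pairing_lam_invol, lam_lam, lam_lam, pairing_lam_invol, pairing_lam_invol]
  simp

end Convolution

section Algebra
open UniformSpace
variable {G : Type*} [Group G] [TopologicalSpace G] [IsTopologicalGroup G]
  [LocallyCompactSpace G] [T2Space G] [MeasurableSpace G] [BorelSpace G]
variable (μ : Measure G) [μ.IsHaarMeasure] [μ.Regular] (p : ℝ≥0∞) [Fact (1 < p)] [Fact (p < ∞)]

instance : Fact (1 ≤ p) := ⟨(Fact.out : 1 < p).le⟩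

instance : Fact (p ≠ ∞) := ⟨(Fact.out : p < ∞).ne⟩

instance : Fact (1 ≤ p.conjExponent) := ⟨ENNReal.HolderConjugate.one_le _ p⟩

instance : Fact (p.conjExponent ≠ ∞) :=
  ⟨((ENNReal.HolderConjugate.lt_top_iff_one_lt p.conjExponent p).2 Fact.out).ne⟩

instance : p.conjExponent.HolderConjugate p := ENNReal.HolderConjugate.symm

/-- `L¹(G)`, to be equipped with convolution, involution and the norm of `PF_p^*(G)`. -/
def L1PF (_p : ℝ≥0∞) : Type _ := Lp ℂ 1 μ

noncomputable instance : AddCommGroup (L1PF μ p) := inferInstanceAs (AddCommGroup (Lp ℂ 1 μ))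

noncomputable instance : Module ℂ (L1PF μ p) := inferInstanceAs (Module ℂ (Lp ℂ 1 μ))

noncomputable instance : Mul (L1PF μ p) := ⟨fun f g => lam μ 1 f g⟩

noncomputable instance : Star (L1PF μ p) := ⟨invol μ⟩

/-- The pair `(λ_p(f), λ_q(f))`, where `q` is conjugate to `p`; the norm of the target is the
maximum of the two operator norms. -/
noncomputable def lamPair : L1PF μ p →ₗ[ℂ] (Lp ℂ p μ →L[ℂ] Lp ℂ p μ) ×
    (Lp ℂ p.conjExponent μ →L[ℂ] Lp ℂ p.conjExponent μ) :=
  LinearMap.prod (lam μ p).toLinearMap (lam μ p.conjExponent).toLinearMap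

noncomputable instance : SeminormedAddCommGroup (L1PF μ p) :=
  SeminormedAddCommGroup.induced _ _ (lamPair μ p)

theorem L1PF.norm_def (f : L1PF μ p) : ‖f‖ = max ‖lam μ p f‖ ‖lam μ p.conjExponent f‖ := rfl

noncomputable instance : NormedSpace ℂ (L1PF μ p) :=
  NormedSpace.induced ℂ _ _ (lamPair μ p)

theorem lam_mul (r : ℝ≥0∞) [Fact (1 ≤ r)] [Fact (r ≠ ∞)] (f g : L1PF μ p) :
    lam μ r (f * g : L1PF μ p) = (lam μ r f).comp (lam μ r g) :=
  ContinuousLinearMap.ext fun h => lam_lam μ r f g h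

noncomputable instance : NonUnitalSeminormedRing (L1PF μ p) where
  __ := (inferInstance : SeminormedAddCommGroup (L1PF μ p))
  left_distrib f g h := map_add (lam μ 1 f) g h
  right_distrib f g h := by
    show lam μ 1 (f + g) h = _
    exact congrArg (fun T => T h) (map_add (lam μ 1) f g)
  zero_mul f := congrArg (fun T => T f) (map_zero (lam μ 1))
  mul_zero f := map_zero (lam μ 1 f)
  mul_assoc f g h := lam_lam μ 1 f g h
  norm_mul_le f g := by
    rw [L1PF.norm_def, L1PF.norm_def, L1PF.norm_def, lam_mul, lam_mul]
    refine max_le ?_ ?_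
    · refine (ContinuousLinearMap.opNorm_comp_le _ _).trans ?_
      gcongr <;> exact le_max_left _ _
    · refine (ContinuousLinearMap.opNorm_comp_le _ _).trans ?_
      gcongr <;> exact le_max_right _ _

instance : IsScalarTower ℂ (L1PF μ p) (L1PF μ p) :=
  ⟨fun c f g => congrArg (fun T => T g) (map_smul (lam μ 1) c f)⟩

instance : SMulCommClass ℂ (L1PF μ p) (L1PF μ p) :=
  ⟨fun c f g => ((lam μ 1 f).map_smul c g).symm⟩

theorem L1PF.norm_star_le (f : L1PF μ p) : ‖star f‖ ≤ ‖f‖ := by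
  rw [L1PF.norm_def, L1PF.norm_def]
  refine max_le ?_ ?_
  · exact (norm_lam_invol_le μ p p.conjExponent f).trans (le_max_right _ _)
  · exact (norm_lam_invol_le μ p.conjExponent p f).trans (le_max_left _ _)

theorem L1PF.star_star (f : L1PF μ p) : star (star f) = f := invol_invol μ f

theorem L1PF.star_add (f g : L1PF μ p) : star (f + g) = star f + star g := invol_add μ f g

theorem L1PF.star_smul (c : ℂ) (f : L1PF μ p) : star (c • f) = star c • star f := invol_smul μ c f

theorem L1PF.norm_star (f : L1PF μ p) : ‖star f‖ = ‖f‖ :=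
  le_antisymm (L1PF.norm_star_le μ p f) <| by
    simpa only [L1PF.star_star] using L1PF.norm_star_le μ p (star f)

theorem L1PF.norm_star_mul (f g : L1PF μ p) : ‖star (f * g) - star g * star f‖ = 0 := by
  have h : ∀ r s : ℝ≥0∞, ∀ [Fact (1 ≤ r)] [Fact (r ≠ ∞)] [Fact (1 ≤ s)] [Fact (s ≠ ∞)]
      [r.HolderConjugate s],
      lam μ r (star (f * g) - star g * star f : L1PF μ p) = 0 := by
    intro r s _ _ _ _ _
    refine (map_sub (lam μ r) _ _).trans (sub_eq_zero.2 ?_)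
    exact lam_invol_lam μ r s f g
  rw [L1PF.norm_def, h p p.conjExponent, h p.conjExponent p, norm_zero, norm_zero, max_self]

/-- The symmetrized algebra of `p`-pseudofunctions `PF_p^*(G)`: the completion of `L¹(G)` for the
norm `max ‖λ_p(f)‖ ‖λ_q(f)‖`. -/
abbrev PFStar : Type _ := Completion (L1PF μ p)

/-- The canonical map `L¹(G) → PF_p^*(G)`. -/
noncomputable def PFStar.of (f : L1PF μ p) : PFStar μ p := (f : Completion (L1PF μ p))

namespace PFStar

open IsDenseInducing Completion

noncomputable instance : Mul (PFStar μ p) :=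
  ⟨Function.curry <| (isDenseInducing_coe.prodMap isDenseInducing_coe).extend
    (((↑) : L1PF μ p → Completion (L1PF μ p)) ∘ Function.uncurry (· * ·))⟩

theorem coe_mul (a b : L1PF μ p) : ((a * b : L1PF μ p) : PFStar μ p) = a * b :=
  ((isDenseInducing_coe.prodMap isDenseInducing_coe).extend_eq
    ((continuous_coe _).comp (@continuous_mul (L1PF μ p) _ _ _)) (a, b)).symm

instance : ContinuousMul (PFStar μ p) where
  continuous_mul := by
    let m := (AddMonoidHom.mul : L1PF μ p →+ L1PF μ p →+ L1PF μ p).compr₂ toCompl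
    have : Continuous fun x : L1PF μ p × L1PF μ p => m x.1 x.2 :=
      (continuous_coe _).comp continuous_mul
    have di : IsDenseInducing (toCompl : L1PF μ p → Completion (L1PF μ p)) := isDenseInducing_coe
    exact (di.extend_Z_bilin di this :)

noncomputable instance : NonUnitalNormedRing (PFStar μ p) where
  __ := (inferInstance : NormedAddCommGroup (PFStar μ p))
  __ := (inferInstance : Mul (PFStar μ p))
  zero_mul a :=
    Completion.induction_on a (isClosed_eq (by fun_prop) continuous_const)
      fun a => by rw [← Completion.coe_zero, ← coe_mul, zero_mul]
  mul_zero a :=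
    Completion.induction_on a (isClosed_eq (by fun_prop) continuous_const)
      fun a => by rw [← Completion.coe_zero, ← coe_mul, mul_zero]
  mul_assoc a b c :=
    Completion.induction_on₃ a b c (isClosed_eq (by fun_prop) (by fun_prop))
      fun a b c => by rw [← coe_mul, ← coe_mul, ← coe_mul, ← coe_mul, mul_assoc]
  left_distrib a b c :=
    Completion.induction_on₃ a b c (isClosed_eq (by fun_prop) (by fun_prop))
      fun a b c => by rw [← Completion.coe_add, ← coe_mul, ← coe_mul, ← coe_mul, ← Completion.coe_add, mul_add]
  right_distrib a b c :=
    Completion.induction_on₃ a b c (isClosed_eq (by fun_prop) (by fun_prop))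
      fun a b c => by rw [← Completion.coe_add, ← coe_mul, ← coe_mul, ← coe_mul, ← Completion.coe_add, add_mul]
  norm_mul_le a b :=
    Completion.induction_on₂ a b (isClosed_le (by fun_prop) (by fun_prop))
      fun a b => by rw [← coe_mul, norm_coe, norm_coe, norm_coe]; exact norm_mul_le a b

theorem smul_mul (c : ℂ) (a b : PFStar μ p) : c • a * b = c • (a * b) := by
  refine Completion.induction_on₂ a b (isClosed_eq ?_ ?_) fun a b => ?_
  · exact (continuous_fst.const_smul c).mul continuous_snd
  · exact (continuous_fst.mul continuous_snd).const_smul c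
  · rw [← Completion.coe_smul c a, ← coe_mul, ← coe_mul, ← Completion.coe_smul c (a * b),
      smul_mul_assoc]

theorem mul_smul (c : ℂ) (a b : PFStar μ p) : a * c • b = c • (a * b) := by
  refine Completion.induction_on₂ a b (isClosed_eq ?_ ?_) fun a b => ?_
  · exact continuous_fst.mul (continuous_snd.const_smul c)
  · exact (continuous_fst.mul continuous_snd).const_smul c
  · rw [← Completion.coe_smul c b, ← coe_mul, ← coe_mul, ← Completion.coe_smul c (a * b),
      mul_smul_comm]

instance : IsScalarTower ℂ (PFStar μ p) (PFStar μ p) := ⟨fun c a b => smul_mul μ p c a b⟩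

instance : SMulCommClass ℂ (PFStar μ p) (PFStar μ p) :=
  ⟨fun c a b => (mul_smul μ p c a b).symm⟩

noncomputable instance : Star (PFStar μ p) := ⟨Completion.map star⟩

theorem uniformContinuous_star : UniformContinuous (star : L1PF μ p → L1PF μ p) :=
  uniformContinuous_addMonoidHom_of_continuous
    (f := AddMonoidHom.mk' (star : L1PF μ p → L1PF μ p) (L1PF.star_add μ p))
    (AddMonoidHomClass.continuous_of_bound _ 1 fun f => by
      rw [one_mul]
      exact L1PF.norm_star_le μ p f)

theorem coe_star (a : L1PF μ p) : ((star a : L1PF μ p) : PFStar μ p) = star (a : PFStar μ p) :=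
  (map_coe (uniformContinuous_star μ p) a).symm

instance : ContinuousStar (PFStar μ p) := ⟨continuous_map⟩

noncomputable instance : StarRing (PFStar μ p) where
  star_involutive a :=
    Completion.induction_on a (isClosed_eq (by fun_prop) (by fun_prop))
      fun a => by rw [← coe_star, ← coe_star, L1PF.star_star]
  star_mul a b :=
    Completion.induction_on₂ a b (isClosed_eq (by fun_prop) (by fun_prop))
      fun a b => by
        rw [← coe_star, ← coe_star, ← coe_mul, ← coe_mul, ← coe_star, ← sub_eq_zero, ← Completion.coe_sub,
          ← norm_eq_zero, norm_coe]
        exact L1PF.norm_star_mul μ p a b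
  star_add a b :=
    Completion.induction_on₂ a b (isClosed_eq (by fun_prop) (by fun_prop))
      fun a b => by rw [← coe_star, ← coe_star, ← Completion.coe_add, ← Completion.coe_add, ← coe_star, L1PF.star_add]

instance : NormedStarGroup (PFStar μ p) where
  norm_star_le a :=
    Completion.induction_on a (isClosed_le (by fun_prop) (by fun_prop))
      fun a => by rw [← coe_star, norm_coe, norm_coe]; exact L1PF.norm_star_le μ p a

instance : StarModule ℂ (PFStar μ p) where
  star_smul c a := by
    refine Completion.induction_on a (isClosed_eq ?_ ?_) fun a => ?_
    · exact (continuous_id.const_smul c).star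
    · exact continuous_id.star.const_smul (star c)
    · rw [← coe_star, ← Completion.coe_smul c a, ← Completion.coe_smul (star c) (star a),
        ← coe_star, L1PF.star_smul]

end PFStar
end Algebra

/-- Amenability of `G`: there is a left-invariant mean on the real space `L^∞(G)`, that is, a
positive, unital linear functional invariant under left translations. -/
def IsAmenable {G : Type*} [Group G] [TopologicalSpace G] [IsTopologicalGroup G]
    [LocallyCompactSpace G] [T2Space G] [MeasurableSpace G] [BorelSpace G]
    (μ : Measure G) [μ.IsHaarMeasure] : Prop :=
  ∃ m : Lp ℝ ∞ μ →ₗ[ℝ] ℝ, (∀ φ, 0 ≤ φ → 0 ≤ m φ) ∧ m ((memLp_top_const (1 : ℝ)).toLp _) = 1 ∧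
    ∀ (s : G) (φ : Lp ℝ ∞ μ), m (leftTranslate μ s φ) = m φ

end PseudoFun

/-! Write `λ_r(f)` for convolution by `f` on `L^r(G)`, and call `f ∈ L¹(G)` a density if its norm
and its integral are one. The hinge is the inequality `|∫ f| ≤ max(‖λ_p(f)‖, ‖λ_q(f)‖)`: it is what
continuity of the trivial representation on `PF_p^*(G)` amounts to, and it is tied to amenability
through densities that are almost invariant under left translation.

From a mean to the representation: if `m` is an invariant mean and `Φ` a bounded real functional on
`L¹(G)`, then `f ↦ m (t ↦ Φ (f * δ_t))` is invariant under right translation, hence takes a single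
value on all densities (`meanFunctional_eq_of_isDensity`). A Hahn–Banach separation turns this into
Reiter's property: densities `g` with `L_s g` close to `g` uniformly for `s` in a compact set. Then
`g^{1/r}` is an almost invariant unit vector of `L^r(G)`, so `λ_r(f) g^{1/r}` is close to `(∫ f)
g^{1/r}` and `|∫ f| ≤ ‖λ_r(f)‖`. The integral therefore extends to the completion.

From the representation to a mean: a multiplicative functional on a Banach algebra is contractive,
which gives the inequality. Applied to `f^* * f`, on which the `λ_p`-norm dominates the `λ_q`-norm,
it shows `‖λ_p(f)‖ ≥ 1` for every density (`one_le_norm_lam_of_isDensity`). If unit vectors `u ∈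
L^p`, `v ∈ L^q` almost attain this norm, then `Re ⟨L_s u, v⟩` is close to one on `f`-average, and
stability of Young's inequality puts `|L_s u|^p` close to `|v|^q` in `L¹` on `f`-average. Choosing
`f` as a mean of finitely many translates of one density produces a density almost invariant under
any given finite set; an ultrafilter limit of such densities is an invariant mean. -/

namespace PseudoFun

open scoped BoundedContinuousFunction

/-! ### Translations on `L¹(G)`, and convolution as an average of right translates -/

section Translations
variable {G : Type*} [Group G] [TopologicalSpace G] [IsTopologicalGroup G]
  [LocallyCompactSpace G] [T2Space G] [MeasurableSpace G] [BorelSpace G]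
variable (μ : Measure G) [μ.IsHaarMeasure] [μ.Regular]

section Left
variable {E : Type*} [NormedAddCommGroup E] {p : ℝ≥0∞}

theorem leftTranslate_add (s : G) (f g : Lp E p μ) :
    leftTranslate μ s (f + g) = leftTranslate μ s f + leftTranslate μ s g := by
  simp only [leftTranslate, smul_add]

theorem leftTranslate_smul {𝕜 : Type*} [NormedField 𝕜] [NormedSpace 𝕜 E] (s : G) (c : 𝕜)
    (g : Lp E p μ) : leftTranslate μ s (c • g) = c • leftTranslate μ s g := by
  simp only [leftTranslate]
  rw [smul_comm]

theorem norm_leftTranslate (s : G) (g : Lp E p μ) : ‖leftTranslate μ s g‖ = ‖g‖ :=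
  DomMulAct.norm_smul_Lp _ _

theorem leftTranslate_leftTranslate (s t : G) (g : Lp E p μ) :
    leftTranslate μ s (leftTranslate μ t g) = leftTranslate μ (s * t) g := by
  simp only [leftTranslate, smul_smul, ← DomMulAct.mk_mul, mul_inv_rev]

theorem leftTranslate_one (g : Lp E p μ) : leftTranslate μ 1 g = g := by
  simp [leftTranslate]

end Left

theorem norm_invol (f : Lp ℂ 1 μ) : ‖invol μ f‖ = ‖f‖ := by
  rw [L1.norm_eq_integral_norm, L1.norm_eq_integral_norm,
    ← integral_modular_smul_inv μ fun s => ‖f s‖]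
  refine integral_congr_ae ?_
  filter_upwards [invol_ae_eq μ f] with s hs
  rw [hs, NNReal.smul_def, norm_smul, RCLike.norm_conj, NNReal.smul_def]
  simp

theorem integral_mul_invol (φ : G → ℂ) (f : Lp ℂ 1 μ) :
    ∫ s, invol μ f s * φ s ∂μ = ∫ s, conj (f s) * φ s⁻¹ ∂μ := by
  rw [← integral_modular_smul_inv μ fun s => conj (f s) * φ s⁻¹]
  refine integral_congr_ae ?_
  filter_upwards [invol_ae_eq μ f] with s hs
  rw [hs, inv_inv, smul_mul_assoc]

theorem integral_mul_leftTranslate (φ : G → ℂ) (f : Lp ℂ 1 μ) (s : G) :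
    ∫ t, leftTranslate μ s f t * φ t ∂μ = ∫ t, f t * φ (s * t) ∂μ := by
  rw [← integral_mul_left_eq_self (fun t => leftTranslate μ s f t * φ t) s]
  have h1 := (measurePreserving_mul_left μ s).quasiMeasurePreserving.ae
    (leftTranslate_ae_eq μ s f)
  refine integral_congr_ae ?_
  filter_upwards [h1] with t ht
  rw [ht, inv_mul_cancel_left]

/-- Right translation `f ↦ f * δ_t` on `L¹(G)`. -/
noncomputable def rightTranslate (t : G) : Lp ℂ 1 μ →L[ℂ] Lp ℂ 1 μ :=
  LinearMap.mkContinuous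
    -- Since `(f * δ_t)^* = δ_{t⁻¹} * f^*`, right translation is left translation conjugated by the
    -- involution. Linearity, isometry and strong continuity are inherited, and the modular function
    -- never has to be handled directly.
    { toFun := fun f => invol μ (leftTranslate μ t⁻¹ (invol μ f))
      map_add' := fun f g => by rw [invol_add, leftTranslate_add, invol_add]
      map_smul' := fun c f => by
        rw [invol_smul, leftTranslate_smul, invol_smul, Complex.conj_conj, RingHom.id_apply] }
    1 fun f => by
      rw [one_mul, LinearMap.coe_mk, AddHom.coe_mk, norm_invol, norm_leftTranslate, norm_invol]

theorem rightTranslate_apply (t : G) (f : Lp ℂ 1 μ) :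
    rightTranslate μ t f = invol μ (leftTranslate μ t⁻¹ (invol μ f)) := rfl

theorem norm_rightTranslate (t : G) (f : Lp ℂ 1 μ) : ‖rightTranslate μ t f‖ = ‖f‖ := by
  rw [rightTranslate_apply, norm_invol, norm_leftTranslate, norm_invol]

theorem rightTranslate_rightTranslate (s t : G) (f : Lp ℂ 1 μ) :
    rightTranslate μ t (rightTranslate μ s f) = rightTranslate μ (s * t) f := by
  rw [rightTranslate_apply, rightTranslate_apply, rightTranslate_apply, invol_invol,
    leftTranslate_leftTranslate, mul_inv_rev]

/-- This identifies `f * δ_t` with the image of the measure `f dμ` under `x ↦ x * t`. Only changes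
of variables are involved, so `φ` may be arbitrary. -/
theorem integral_mul_rightTranslate (φ : G → ℂ) (f : Lp ℂ 1 μ) (t : G) :
    ∫ x, rightTranslate μ t f x * φ x ∂μ = ∫ x, f x * φ (x * t) ∂μ := by
  have hconj : ∀ h : Lp ℂ 1 μ, ∀ ψ : G → ℂ, ∫ x, conj (h x) * ψ x ∂μ =
      conj (∫ x, h x * conj (ψ x) ∂μ) := fun h ψ => by
    rw [← integral_conj]
    simp only [map_mul, Complex.conj_conj]
  rw [rightTranslate_apply, integral_mul_invol, hconj,
    integral_mul_leftTranslate μ (fun x => conj (φ x⁻¹)), integral_mul_invol μ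
      (fun x => conj (φ (t⁻¹ * x)⁻¹)), hconj, Complex.conj_conj]
  simp

theorem continuous_invol : Continuous (invol μ) := by
  refine (LipschitzWith.of_dist_le_mul (K := 1) fun f g => ?_).continuous
  have : invol μ f - invol μ g = invol μ (f - g) := by
    rw [sub_eq_iff_eq_add, ← invol_add, sub_add_cancel]
  rw [dist_eq_norm, this, norm_invol, dist_eq_norm, NNReal.coe_one, one_mul]

theorem continuous_rightTranslate (f : Lp ℂ 1 μ) : Continuous fun t => rightTranslate μ t f :=
  (continuous_invol μ).comp ((continuous_leftTranslate μ 1 (invol μ f)).comp continuous_inv)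

/-- The bounded continuous orbit map `t ↦ f * δ_t`, as a linear map of `f`. -/
noncomputable def rightOrbit : Lp ℂ 1 μ →L[ℂ] (G →ᵇ Lp ℂ 1 μ) :=
  LinearMap.mkContinuous
    { toFun := fun f => BoundedContinuousFunction.ofNormedAddCommGroup
        (fun t => rightTranslate μ t f) (continuous_rightTranslate μ f) ‖f‖
        fun t => (norm_rightTranslate μ t f).le
      map_add' := fun f g => by ext1 t; exact map_add (rightTranslate μ t) f g
      map_smul' := fun c f => by ext1 t; exact map_smul (rightTranslate μ t) c f }
    1 fun f => by
      rw [one_mul]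
      exact (BoundedContinuousFunction.norm_le (norm_nonneg f)).2 fun t =>
        (norm_rightTranslate μ t f).le

theorem rightOrbit_apply (f : Lp ℂ 1 μ) (t : G) : rightOrbit μ f t = rightTranslate μ t f := rfl

section Integral
variable {E : Type*} [NormedAddCommGroup E] [NormedSpace ℂ E]

theorem integrable_smul_bounded (f : Lp ℂ 1 μ) (F : G →ᵇ E) :
    Integrable (fun s => f s • F s) μ := by
  have hf := L1.integrable_coeFn f
  refine Integrable.mono' (hf.norm.mul_const ‖F‖) (aestronglyMeasurable_smul μ hf F.continuous)
    (ae_of_all _ fun s => ?_)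
  rw [norm_smul]
  gcongr
  exact F.norm_coe_le_norm s

/-- The weighted average `∫ f(s) F(s) ds` of a bounded continuous vector-valued function. -/
noncomputable def integralSmul : (G →ᵇ E) →L[ℂ] Lp ℂ 1 μ →L[ℂ] E :=
  LinearMap.mkContinuous₂
    (LinearMap.mk₂ ℂ (fun (F : G →ᵇ E) (f : Lp ℂ 1 μ) => ∫ s, f s • F s ∂μ)
      (by
        intro F F' f
        rw [← integral_add (integrable_smul_bounded μ f F) (integrable_smul_bounded μ f F')]
        simp only [BoundedContinuousFunction.coe_add, Pi.add_apply, smul_add])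
      (by
        intro c F f
        rw [← integral_smul]
        refine integral_congr_ae (ae_of_all _ fun s => ?_)
        simp only [BoundedContinuousFunction.coe_smul]
        rw [smul_comm])
      (by
        intro F f f'
        rw [← integral_add (integrable_smul_bounded μ f F) (integrable_smul_bounded μ f' F)]
        refine integral_congr_ae ?_
        filter_upwards [Lp.coeFn_add f f'] with s hs
        rw [hs, Pi.add_apply, add_smul])
      (by
        intro c F f
        rw [← integral_smul]
        refine integral_congr_ae ?_
        filter_upwards [Lp.coeFn_smul c f] with s hs
        rw [hs, Pi.smul_apply, smul_assoc]))
    1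
    (by
      intro F f
      rw [one_mul, L1.norm_eq_integral_norm, mul_comm, ← integral_mul_const]
      refine norm_integral_le_of_norm_le ((L1.integrable_coeFn f).norm.mul_const _)
        (ae_of_all _ fun s => ?_)
      rw [norm_smul]
      gcongr
      exact F.norm_coe_le_norm s)

theorem integralSmul_apply (F : G →ᵇ E) (f : Lp ℂ 1 μ) :
    integralSmul μ F f = ∫ s, f s • F s ∂μ := rfl

end Integral

/-- Density of `C_c(G)` in `L¹(G)`. A set of finite measure is approximated from inside by a compact
set, that one from outside by an open set, and a Urysohn function between the two replaces the
indicator. -/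
theorem exists_hasCompactSupport_eLpNorm_one_sub_le {f : G → ℂ} (hf : MemLp f 1 μ) {ε : ℝ≥0∞}
    (hε : ε ≠ 0) : ∃ g : G → ℂ, eLpNorm (f - g) 1 μ ≤ ε ∧ Continuous g ∧ HasCompactSupport g := by
  refine hf.induction_dense ENNReal.one_ne_top (fun g => Continuous g ∧ HasCompactSupport g)
    ?_ ?_ (fun f hf => (hf.1.integrable_of_hasCompactSupport hf.2).aestronglyMeasurable) hε
  swap
  · rintro f g ⟨hfc, hfs⟩ ⟨hgc, hgs⟩
    exact ⟨hfc.add hgc, HasCompactSupport.add hfs hgs⟩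
  intro c t ht htμ ε hε
  obtain ⟨δ, δpos, hδ⟩ := exists_Lp_half ℂ μ 1 hε
  obtain ⟨η, ηpos, hη⟩ :
      ∃ η : ℝ≥0, 0 < η ∧ ∀ s : Set G, μ s ≤ η → eLpNorm (s.indicator fun _ => c) 1 μ ≤ δ :=
    exists_eLpNorm_indicator_le ENNReal.one_ne_top c δpos.ne'
  have η0 : (η : ℝ≥0∞) ≠ 0 := by exact_mod_cast ηpos.ne'
  obtain ⟨s, st, hs, μs⟩ := ht.exists_isCompact_sdiff_lt htμ.ne η0
  obtain ⟨V, sV, hV, -, μV⟩ := 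
    hs.measurableSet.exists_isOpen_sdiff_lt (hs.measure_lt_top (μ := μ)).ne η0
  obtain ⟨g, gs, gV, gc, g01⟩ := exists_continuous_one_zero_of_isCompact hs hV.isClosed_compl
    (disjoint_compl_right_iff_subset.2 sV)
  have hgc : Continuous fun x => g x • c := by fun_prop
  have hgs : HasCompactSupport fun x => g x • c := gc.smul_right
  have I1 : eLpNorm ((s.indicator fun _ => c) - t.indicator fun _ => c) 1 μ ≤ δ := by
    rw [← eLpNorm_neg, neg_sub, ← indicator_sdiff st]
    exact hη _ μs.le
  have I2 : eLpNorm ((fun x => g x • c) - s.indicator fun _ => c) 1 μ ≤ δ := by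
    refine (eLpNorm_mono fun x => ?_).trans (hη _ μV.le)
    by_cases hxs : x ∈ s
    · simp [hxs, gs hxs]
    · by_cases hxV : x ∈ V
      · simp only [Pi.sub_apply, indicator_of_notMem hxs, sub_zero,
          indicator_of_mem (show x ∈ V \ s from ⟨hxV, hxs⟩), norm_smul,
          Real.norm_of_nonneg (g01 x).1]
        exact mul_le_of_le_one_left (norm_nonneg _) (g01 x).2
      · simp [hxs, gV hxV]
  refine ⟨fun x => g x • c, ?_, hgc, hgs⟩
  have hgm : AEStronglyMeasurable (fun x => g x • c) μ :=
    (hgc.integrable_of_hasCompactSupport (μ := μ) hgs).aestronglyMeasurable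
  convert! (hδ _ _ (hgm.sub
    (aestronglyMeasurable_const.indicator hs.measurableSet))
    ((aestronglyMeasurable_const.indicator hs.measurableSet).sub
      (aestronglyMeasurable_const.indicator ht)) I2 I1).le using 2
  simp only [sub_add_sub_cancel]

theorem L1_induction_of_hasCompactSupport {P : Lp ℂ 1 μ → Prop} (hP : IsClosed {f | P f})
    (h : ∀ (f : G → ℂ) (_ : Continuous f) (_ : HasCompactSupport f) (hf : MemLp f 1 μ),
      P (hf.toLp f)) (f : Lp ℂ 1 μ) : P f := by
  refine hP.closure_subset (Metric.mem_closure_iff.2 fun ε hε => ?_)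
  obtain ⟨g, hg, hgc, hgs⟩ := exists_hasCompactSupport_eLpNorm_one_sub_le μ (Lp.memLp f)
    (ε := ENNReal.ofReal (ε / 2)) (by simpa using hε)
  have hgL : MemLp g 1 μ := memLp_one_iff_integrable.2 (hgc.integrable_of_hasCompactSupport hgs)
  refine ⟨hgL.toLp g, h g hgc hgs hgL, ?_⟩
  have h1 : f = (Lp.memLp f).toLp f := (Lp.toLp_coeFn f _).symm
  rw [dist_eq_norm]
  conv_lhs => rw [h1]
  rw [← MemLp.toLp_sub, Lp.norm_toLp]
  refine (ENNReal.toReal_le_of_le_ofReal (by positivity) hg).trans_lt (by linarith)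

/-- A `C_c` approximation `g` of `f` supplies the test function: `conj g / (‖g‖ + δ)` is a
continuous, compactly supported substitute for the phase of `g`, and pairing it with `g` almost
recovers `‖g‖₁`. -/
theorem eq_zero_of_integral_mul_hasCompactSupport (f : Lp ℂ 1 μ)
    (h : ∀ φ : G →ᵇ ℂ, HasCompactSupport φ → ∫ x, f x * φ x ∂μ = 0) : f = 0 := by
  rw [← norm_le_zero_iff]
  refine le_of_forall_pos_le_add fun ε hε => ?_
  obtain ⟨g, hg, hgc, hgs⟩ := exists_hasCompactSupport_eLpNorm_one_sub_le μ (Lp.memLp f)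
    (ε := ENNReal.ofReal (ε / 3)) (by simpa using hε)
  have hgi := hgc.integrable_of_hasCompactSupport (μ := μ) hgs
  replace hg : ∫ x, ‖f x - g x‖ ∂μ ≤ ε / 3 := by
    rw [integral_norm_eq_lintegral_enorm (f := fun x => f x - g x)
      ((Lp.aestronglyMeasurable f).sub hgi.aestronglyMeasurable)]
    rw [eLpNorm_one_eq_lintegral_enorm] at hg
    exact ENNReal.toReal_le_of_le_ofReal (by positivity) hg
  set M := μ.real (tsupport g)
  have hM : 0 ≤ M := measureReal_nonneg
  -- Regularising the phase costs at most `δ` at each point of the support of `g`, so `δ * M ≤ ε /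
  -- 3` is needed; `M + 1` avoids dividing by zero.
  set δ : ℝ := ε / (3 * (M + 1)) with hδ
  have hδ0 : 0 < δ := by positivity
  have hden : ∀ x, (0 : ℝ) < ‖g x‖ + δ := fun x => by positivity
  have hcont : Continuous fun x => conj (g x) / ((‖g x‖ + δ : ℝ) : ℂ) := by
    refine (Complex.continuous_conj.comp hgc).div
      (Complex.continuous_ofReal.comp (hgc.norm.add continuous_const)) fun x => ?_
    exact_mod_cast (hden x).ne'
  have hle : ∀ x, ‖conj (g x) / ((‖g x‖ + δ : ℝ) : ℂ)‖ ≤ 1 := fun x => by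
    rw [norm_div, RCLike.norm_conj, Complex.norm_real, Real.norm_of_nonneg (hden x).le,
      div_le_one (hden x)]
    linarith
  let φ : G →ᵇ ℂ := BoundedContinuousFunction.ofNormedAddCommGroup _ hcont 1 hle
  have hφ : ∀ x, φ x = conj (g x) / ((‖g x‖ + δ : ℝ) : ℂ) := fun x => rfl
  have hφs : HasCompactSupport φ := hgs.mono fun x hx hg0 => hx <| by simp [hφ, hg0]
  have hgφ : ∀ x, g x * φ x = ((‖g x‖ ^ 2 / (‖g x‖ + δ) : ℝ) : ℂ) := fun x => by
    rw [hφ, mul_div_assoc', Complex.mul_conj, Complex.normSq_eq_norm_sq]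
    push_cast
    rfl
  have hfi := L1.integrable_coeFn f
  have hfφ : Integrable (fun x => f x * φ x) μ := integrable_smul_bounded μ f φ
  have hgφi : Integrable (fun x => g x * φ x) μ :=
    (hgc.mul φ.continuous).integrable_of_hasCompactSupport (hgs.mul_right)
  have h1 : ∫ x, ‖g x‖ ^ 2 / (‖g x‖ + δ) ∂μ ≤ ε / 3 := by
    have e : ((∫ x, ‖g x‖ ^ 2 / (‖g x‖ + δ) ∂μ : ℝ) : ℂ) = ∫ x, (g x * φ x - f x * φ x) ∂μ := by
      rw [integral_sub hgφi hfφ, h φ hφs, sub_zero, ← integral_complex_ofReal]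
      simp only [hgφ]
    calc ∫ x, ‖g x‖ ^ 2 / (‖g x‖ + δ) ∂μ ≤ ‖((∫ x, ‖g x‖ ^ 2 / (‖g x‖ + δ) ∂μ : ℝ) : ℂ)‖ := by
          rw [Complex.norm_real]; exact Real.le_norm_self _
      _ ≤ ∫ x, ‖f x - g x‖ ∂μ := by
          rw [e]
          refine norm_integral_le_of_norm_le (hfi.sub hgi).norm (ae_of_all _ fun x => ?_)
          rw [← sub_mul, norm_mul, norm_sub_rev]
          exact mul_le_of_le_one_right (norm_nonneg _) (hle x)
      _ ≤ _ := hg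
  have h2 : ∫ x, ‖g x‖ ∂μ ≤ ∫ x, ‖g x‖ ^ 2 / (‖g x‖ + δ) ∂μ + δ * M := by
    have hi : Integrable (fun x => ‖g x‖ ^ 2 / (‖g x‖ + δ)) μ := by
      refine hgφi.norm.congr (ae_of_all _ fun x => ?_)
      simp only [hgφ, Complex.norm_real]
      exact Real.norm_of_nonneg (by positivity)
    have hind : Integrable ((tsupport g).indicator fun _ => δ) μ :=
      (integrable_indicator_iff hgs.isCompact.measurableSet).2
        (integrableOn_const hgs.isCompact.measure_lt_top.ne)
    have e : δ * M = ∫ x, (tsupport g).indicator (fun _ => δ) x ∂μ := by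
      rw [integral_indicator hgs.isCompact.measurableSet, setIntegral_const, smul_eq_mul, mul_comm]
    rw [e, ← integral_add hi hind]
    refine integral_mono hgi.norm (hi.add hind) fun x => ?_
    by_cases hx : x ∈ tsupport g
    · simp only [indicator_of_mem hx]
      rw [← sub_nonneg]
      have : ‖g x‖ ^ 2 / (‖g x‖ + δ) + δ - ‖g x‖ = δ ^ 2 / (‖g x‖ + δ) := by
        field_simp [(hden x).ne']
        ring
      rw [this]
      positivity
    · simp [image_eq_zero_of_notMem_tsupport hx, indicator_of_notMem hx]
  have h3 : ‖f‖ ≤ ∫ x, ‖f x - g x‖ ∂μ + ∫ x, ‖g x‖ ∂μ := by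
    have hi : Integrable (fun x => ‖f x - g x‖) μ := (hfi.sub hgi).norm
    rw [L1.norm_eq_integral_norm, ← integral_add hi hgi.norm]
    refine integral_mono hfi.norm (hi.add hgi.norm) fun x => ?_
    simpa using norm_add_le (f x - g x) (g x)
  have h4 : δ * M ≤ ε / 3 := by
    rw [hδ, div_mul_eq_mul_div, div_le_div_iff₀ (by positivity) (by positivity)]
    nlinarith
  linarith

theorem integral_lam_mul (f g : Lp ℂ 1 μ) (φ : G →ᵇ ℂ) :
    ∫ x, lam μ 1 f g x * φ x ∂μ = ∫ s, f s * ∫ t, g t * φ (s * t) ∂μ ∂μ := by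
  have h1 : ∀ h : Lp ℂ 1 μ, ∫ x, h x * φ x ∂μ = integralSmul μ φ h := fun h => rfl
  rw [h1, lam_apply, ← ContinuousLinearMap.integral_comp_comm _
    (integrable_smul_leftTranslate μ 1 f g)]
  refine integral_congr_ae (ae_of_all _ fun s => ?_)
  simp only [map_smul, smul_eq_mul]
  rw [← h1, integral_mul_leftTranslate]

theorem integral_integralSmul_rightOrbit_mul (f g : Lp ℂ 1 μ) (φ : G →ᵇ ℂ) :
    ∫ x, integralSmul μ (rightOrbit μ f) g x * φ x ∂μ =
      ∫ t, g t * ∫ s, f s * φ (s * t) ∂μ ∂μ := by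
  have h1 : ∀ h : Lp ℂ 1 μ, ∫ x, h x * φ x ∂μ = integralSmul μ φ h := fun h => rfl
  rw [h1, integralSmul_apply μ (rightOrbit μ f), ← ContinuousLinearMap.integral_comp_comm _
    (integrable_smul_bounded μ g _)]
  refine integral_congr_ae (ae_of_all _ fun s => ?_)
  simp only [map_smul, smul_eq_mul, rightOrbit_apply]
  rw [← h1, integral_mul_rightTranslate]

/-- Convolution as an average of right translates: `f * g = ∫ g(t) (f * δ_t) dt`. -/
theorem lam_eq_integralSmul_rightOrbit (f g : Lp ℂ 1 μ) :
    lam μ 1 f g = integralSmul μ (rightOrbit μ f) g := by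
  -- The claim is Fubini's theorem tested against `φ`. Haar measure need not be σ-finite, so both
  -- factors are first reduced to `C_c(G)`, where the integrand has compact support in the product
  -- and the swap is legitimate.
  refine L1_induction_of_hasCompactSupport μ (P := fun f =>
    lam μ 1 f g = integralSmul μ (rightOrbit μ f) g) (isClosed_eq (by fun_prop) (by fun_prop))
    (fun f hfc hfs hf => ?_) f
  refine L1_induction_of_hasCompactSupport μ (P := fun g =>
    lam μ 1 _ g = integralSmul μ (rightOrbit μ _) g) (isClosed_eq (by fun_prop) (by fun_prop))
    (fun g hgc hgs hg => ?_) g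
  rw [← sub_eq_zero]
  refine eq_zero_of_integral_mul_hasCompactSupport μ _ fun φ hφ => ?_
  have h1 : ∀ h : Lp ℂ 1 μ, ∫ x, h x * φ x ∂μ = integralSmul μ φ h := fun h => rfl
  rw [h1, map_sub, ← h1, ← h1, integral_lam_mul, integral_integralSmul_rightOrbit_mul, sub_eq_zero]
  have e1 : ∀ s, ∫ t, hg.toLp g t * φ (s * t) ∂μ = ∫ t, g t * φ (s * t) ∂μ := fun s =>
    integral_congr_ae (hg.coeFn_toLp.mono fun t ht => by simp only [ht])
  have e2 : ∀ t, ∫ s, hf.toLp f s * φ (s * t) ∂μ = ∫ s, f s * φ (s * t) ∂μ := fun s =>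
    integral_congr_ae (hf.coeFn_toLp.mono fun t ht => by simp only [ht])
  simp only [e1, e2]
  have e3 : ∫ s, hf.toLp f s * ∫ t, g t * φ (s * t) ∂μ ∂μ =
      ∫ s, ∫ t, f s * (g t * φ (s * t)) ∂μ ∂μ :=
    integral_congr_ae (hf.coeFn_toLp.mono fun t ht => by
      simp only [ht]; rw [← integral_const_mul])
  have e4 : ∫ t, hg.toLp g t * ∫ s, f s * φ (s * t) ∂μ ∂μ =
      ∫ t, ∫ s, f s * (g t * φ (s * t)) ∂μ ∂μ :=
    integral_congr_ae (hg.coeFn_toLp.mono fun t ht => by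
      simp only [ht]
      rw [← integral_const_mul]
      congr 1 with s
      ring)
  rw [e3, e4]
  refine integral_integral_swap_of_hasCompactSupport (f := fun s t => f s * (g t * φ (s * t)))
    (by fun_prop) ?_
  refine HasCompactSupport.intro (hfs.isCompact.prod hgs.isCompact) fun x hx => ?_
  rw [mem_prod, not_and_or] at hx
  rcases hx with hx | hx
  · simp [Function.uncurry, image_eq_zero_of_notMem_tsupport hx]
  · simp [Function.uncurry, image_eq_zero_of_notMem_tsupport hx]

end Translations
-- Probability densities
section Density
variable {G : Type*} [Group G] [TopologicalSpace G] [IsTopologicalGroup G]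
  [LocallyCompactSpace G] [T2Space G] [MeasurableSpace G] [BorelSpace G]
variable (μ : Measure G) [μ.IsHaarMeasure] [μ.Regular]

/-- The integral as a bounded functional on `L¹(G)`. -/
noncomputable def totalIntegral : Lp ℂ 1 μ →L[ℂ] ℂ :=
  integralSmul μ (BoundedContinuousFunction.const G (1 : ℂ))

theorem totalIntegral_apply (f : Lp ℂ 1 μ) : totalIntegral μ f = ∫ s, f s ∂μ := by
  simp [totalIntegral, integralSmul_apply]

theorem norm_totalIntegral_le (f : Lp ℂ 1 μ) : ‖totalIntegral μ f‖ ≤ ‖f‖ := by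
  rw [totalIntegral_apply, L1.norm_eq_integral_norm]
  exact norm_integral_le_integral_norm _

theorem totalIntegral_leftTranslate (s : G) (f : Lp ℂ 1 μ) :
    totalIntegral μ (leftTranslate μ s f) = totalIntegral μ f := by
  have := integral_mul_leftTranslate μ (fun _ => 1) f s
  simpa only [totalIntegral_apply, mul_one] using this

theorem totalIntegral_lam (f g : Lp ℂ 1 μ) :
    totalIntegral μ (lam μ 1 f g) = totalIntegral μ f * totalIntegral μ g := by
  rw [lam_apply, ← ContinuousLinearMap.integral_comp_comm _
    (integrable_smul_leftTranslate μ 1 f g), totalIntegral_apply μ f, ← integral_mul_const]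
  simp only [map_smul, smul_eq_mul, totalIntegral_leftTranslate]

theorem totalIntegral_invol (f : Lp ℂ 1 μ) :
    totalIntegral μ (invol μ f) = conj (totalIntegral μ f) := by
  have := integral_mul_invol μ (fun _ => 1) f
  simp only [mul_one] at this
  rw [totalIntegral_apply, totalIntegral_apply, this, integral_conj]

theorem norm_lam_le (f g : Lp ℂ 1 μ) : ‖lam μ 1 f g‖ ≤ ‖f‖ * ‖g‖ := by
  rw [lam_apply, L1.norm_eq_integral_norm f, ← integral_mul_const]
  refine norm_integral_le_of_norm_le ((L1.integrable_coeFn f).norm.mul_const _)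
    (ae_of_all _ fun s => ?_)
  rw [norm_smul, norm_leftTranslate]

/-- `f ∈ L¹(G)` is a probability density; this forces `0 ≤ f`. -/
def IsDensity (f : Lp ℂ 1 μ) : Prop := ‖f‖ ≤ 1 ∧ totalIntegral μ f = 1

variable {μ}

theorem IsDensity.norm_eq {f : Lp ℂ 1 μ} (hf : IsDensity μ f) : ‖f‖ = 1 := by
  refine le_antisymm hf.1 ?_
  have := norm_totalIntegral_le μ f
  rwa [hf.2, norm_one] at this

/-- Equality case of `|∫ f| ≤ ∫ |f|`: the nonnegative function `|f| - Re f` has integral zero. -/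
theorem IsDensity.ae_eq_norm {f : Lp ℂ 1 μ} (hf : IsDensity μ f) :
    ∀ᵐ x ∂μ, f x = ((‖f x‖ : ℝ) : ℂ) := by
  have hi := L1.integrable_coeFn f
  have h0 : ∫ x, (‖f x‖ - (f x).re) ∂μ = 0 := by
    have h1 : ∫ x, (f x).re ∂μ = 1 := by
      have := integral_re (𝕜 := ℂ) hi
      simp only [RCLike.re_to_complex] at this
      rw [this, ← totalIntegral_apply, hf.2, Complex.one_re]
    have hre : Integrable (fun x => (f x).re) μ := hi.re
    rw [integral_sub hi.norm hre, h1, ← L1.norm_eq_integral_norm, hf.norm_eq, sub_self]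
  rw [integral_eq_zero_iff_of_nonneg (fun x => sub_nonneg.2 (Complex.re_le_norm _))
    (hi.norm.sub hi.re)] at h0
  filter_upwards [h0] with x hx
  have hx' : (f x).re = ‖f x‖ := (sub_eq_zero.1 hx).symm
  rw [← hx']
  exact Complex.ext rfl (Complex.nonneg_iff.1 (Complex.re_eq_norm.1 hx')).2.symm

theorem convex_isDensity : Convex ℝ {f : Lp ℂ 1 μ | IsDensity μ f} := by
  rintro f ⟨hf, hf'⟩ g ⟨hg, hg'⟩ a b ha hb hab
  refine ⟨?_, ?_⟩
  · refine (norm_add_le _ _).trans ?_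
    rw [norm_smul, norm_smul, Real.norm_of_nonneg ha, Real.norm_of_nonneg hb, ← hab]
    nlinarith
  · rw [map_add, map_real_smul (totalIntegral μ) (totalIntegral μ).continuous,
      map_real_smul (totalIntegral μ) (totalIntegral μ).continuous, hf', hg', ← add_smul, hab,
      one_smul]

theorem IsDensity.translate {f : Lp ℂ 1 μ} (hf : IsDensity μ f) (s : G) :
    IsDensity μ (leftTranslate μ s f) :=
  ⟨(norm_leftTranslate μ s f).trans_le hf.1, (totalIntegral_leftTranslate μ s f).trans hf.2⟩

theorem IsDensity.convolve {f g : Lp ℂ 1 μ} (hf : IsDensity μ f) (hg : IsDensity μ g) :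
    IsDensity μ (lam μ 1 f g) :=
  ⟨(norm_lam_le μ f g).trans (mul_le_one₀ hf.1 (norm_nonneg _) hg.1), by
    rw [totalIntegral_lam, hf.2, hg.2, mul_one]⟩

theorem IsDensity.invol {f : Lp ℂ 1 μ} (hf : IsDensity μ f) : IsDensity μ (invol μ f) :=
  ⟨(norm_invol μ f).trans_le hf.1, by rw [totalIntegral_invol, hf.2, map_one]⟩

/-- Averaging against a density concentrated near a point almost evaluates there. This serves as the
approximate identity, for left and for right translates alike. -/
theorem IsDensity.norm_integral_smul_sub_le {E : Type*} [NormedAddCommGroup E] [NormedSpace ℂ E]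
    [CompleteSpace E] {e : Lp ℂ 1 μ} (he : IsDensity μ e) {F : G → E}
    (hF : Integrable (fun s => e s • F s) μ) (y : E) {ε : ℝ}
    (h : ∀ᵐ s ∂μ, e s ≠ 0 → ‖F s - y‖ ≤ ε) : ‖∫ s, e s • F s ∂μ - y‖ ≤ ε := by
  have hi := L1.integrable_coeFn e
  have h1 : y = ∫ s, e s • y ∂μ := by
    rw [integral_smul_const, ← totalIntegral_apply, he.2, one_smul]
  have h2 : ε = ∫ s, ‖e s‖ * ε ∂μ := by
    rw [integral_mul_const, ← L1.norm_eq_integral_norm, he.norm_eq, one_mul]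
  conv_lhs => rw [h1]
  rw [← integral_sub hF (hi.smul_const y), h2]
  refine norm_integral_le_of_norm_le (hi.norm.mul_const _) ?_
  filter_upwards [h] with s hs
  rw [← smul_sub, norm_smul]
  by_cases h0 : e s = 0
  · simp [h0]
  · gcongr
    exact hs h0

variable (μ)

theorem exists_isDensity_of_mem_nhds {t : G} {U : Set G} (hU : U ∈ 𝓝 t) :
    ∃ e : Lp ℂ 1 μ, IsDensity μ e ∧ ∀ᵐ s ∂μ, e s ≠ 0 → s ∈ U := by
  obtain ⟨K, hKt, hKU, hK⟩ := local_compact_nhds hU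
  have hpos : 0 < μ.real K :=
    ENNReal.toReal_pos (measure_pos_of_mem_nhds μ hKt).ne' hK.measure_lt_top.ne
  have hm := hK.measurableSet
  have hfin := (hK.measure_lt_top (μ := μ)).ne
  have hae := indicatorConstLp_coeFn (p := 1) (hs := hm) (hμs := hfin)
    (c := (((μ.real K)⁻¹ : ℝ) : ℂ))
  refine ⟨indicatorConstLp 1 hm hfin (((μ.real K)⁻¹ : ℝ) : ℂ), ⟨?_, ?_⟩, ?_⟩
  · rw [norm_indicatorConstLp one_ne_zero ENNReal.one_ne_top, Complex.norm_real,
      Real.norm_of_nonneg (by positivity)]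
    simp [inv_mul_cancel₀ hpos.ne']
  · rw [totalIntegral_apply, integral_indicatorConstLp, Complex.real_smul, ← Complex.ofReal_mul,
      mul_inv_cancel₀ hpos.ne', Complex.ofReal_one]
  · filter_upwards [hae] with s hs h0
    by_contra hsU
    rw [hs, indicator_of_notMem fun h => hsU (hKU h)] at h0
    exact h0 rfl

end Density

/-! ### From an invariant mean to Reiter's property -/

section Mean
variable {G : Type*} [Group G] [TopologicalSpace G] [IsTopologicalGroup G]
  [LocallyCompactSpace G] [T2Space G] [MeasurableSpace G] [BorelSpace G]
variable (μ : Measure G) [μ.IsHaarMeasure] [μ.Regular]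

theorem memLp_top_boundedContinuous (φ : G →ᵇ ℝ) : MemLp φ ∞ μ :=
  memLp_top_of_bound φ.continuous.aestronglyMeasurable ‖φ‖ (ae_of_all _ φ.norm_coe_le_norm)

/-- The canonical map from bounded continuous functions to `L^∞(G)`. -/
noncomputable def toLinfty : (G →ᵇ ℝ) →ₗ[ℝ] Lp ℝ ∞ μ where
  toFun φ := (memLp_top_boundedContinuous μ φ).toLp φ
  map_add' φ ψ := MemLp.toLp_add (memLp_top_boundedContinuous μ φ) (memLp_top_boundedContinuous μ ψ)
  map_smul' c φ := (memLp_top_boundedContinuous μ φ).toLp_const_smul c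

theorem coeFn_toLinfty (φ : G →ᵇ ℝ) : toLinfty μ φ =ᵐ[μ] φ :=
  (memLp_top_boundedContinuous μ φ).coeFn_toLp

theorem leftTranslate_toLinfty (s : G) (φ ψ : G →ᵇ ℝ) (h : ∀ t, ψ t = φ (s⁻¹ * t)) :
    leftTranslate μ s (toLinfty μ φ) = toLinfty μ ψ := by
  refine Lp.ext ?_
  filter_upwards [leftTranslate_ae_eq μ s (toLinfty μ φ), coeFn_toLinfty μ ψ,
    (measurePreserving_mul_left μ s⁻¹).quasiMeasurePreserving.ae (coeFn_toLinfty μ φ)]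
    with t h1 h2 h3
  rw [h1, h2, h3, h]

/-- A left-invariant mean on `L^∞(G)`. -/
structure IsInvariantMean (m : Lp ℝ ∞ μ →ₗ[ℝ] ℝ) : Prop where
  nonneg : ∀ φ, 0 ≤ φ → 0 ≤ m φ
  one : m ((memLp_top_const (1 : ℝ)).toLp _) = 1
  invariant : ∀ (s : G) (φ : Lp ℝ ∞ μ), m (leftTranslate μ s φ) = m φ

variable {μ} {m : Lp ℝ ∞ μ →ₗ[ℝ] ℝ} (hm : IsInvariantMean μ m)
include hm

theorem IsInvariantMean.le_apply {φ : G →ᵇ ℝ} {c : ℝ} (h : ∀ t, c ≤ φ t) :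
    c ≤ m (toLinfty μ φ) := by
  have h1 : m (toLinfty μ (BoundedContinuousFunction.const G 1)) = 1 := hm.one
  have h2 : 0 ≤ m (toLinfty μ (φ - c • BoundedContinuousFunction.const G 1)) := by
    refine hm.nonneg _ ((Lp.coeFn_nonneg _).1 ?_)
    filter_upwards [coeFn_toLinfty μ (φ - c • BoundedContinuousFunction.const G 1)] with t ht
    rw [ht]
    simpa using h t
  rw [map_sub, map_sub, map_smul, map_smul, h1, smul_eq_mul, mul_one] at h2
  linarith

theorem IsInvariantMean.abs_apply_le (φ : G →ᵇ ℝ) : |m (toLinfty μ φ)| ≤ ‖φ‖ := by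
  rw [abs_le]
  refine ⟨hm.le_apply fun t => (abs_le.1 (φ.norm_coe_le_norm t)).1, ?_⟩
  have := hm.le_apply (φ := -φ) (c := -‖φ‖) fun t => by
    simpa using (abs_le.1 (φ.norm_coe_le_norm t)).2
  rw [map_neg, map_neg] at this
  linarith

/-- The functional `f ↦ m (t ↦ Φ (f * δ_t))` on `L¹(G)`. -/
noncomputable def meanFunctional (Φ : Lp ℂ 1 μ →L[ℝ] ℝ) : Lp ℂ 1 μ →L[ℝ] ℝ :=
  LinearMap.mkContinuous
    (m ∘ₗ toLinfty μ ∘ₗ (Φ.compLeftContinuousBounded G).toLinearMap ∘ₗ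
      ((rightOrbit μ).restrictScalars ℝ).toLinearMap)
    (‖Φ.compLeftContinuousBounded G‖ * ‖rightOrbit μ‖)
    fun f => by
      refine (hm.abs_apply_le _).trans ?_
      refine ((Φ.compLeftContinuousBounded G).le_opNorm _).trans ?_
      rw [mul_assoc]
      gcongr
      exact (rightOrbit μ).le_opNorm f

theorem meanFunctional_apply (Φ : Lp ℂ 1 μ →L[ℝ] ℝ) (f : Lp ℂ 1 μ) :
    meanFunctional hm Φ f = m (toLinfty μ (Φ.compLeftContinuousBounded G (rightOrbit μ f))) := rfl

/-- Replacing `f` by `f * δ_s` changes the orbit map `t ↦ f * δ_t` into its left translate by `s⁻¹`,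
which `m` does not notice. -/
theorem meanFunctional_rightTranslate (Φ : Lp ℂ 1 μ →L[ℝ] ℝ) (s : G) (f : Lp ℂ 1 μ) :
    meanFunctional hm Φ (rightTranslate μ s f) = meanFunctional hm Φ f := by
  rw [meanFunctional_apply, meanFunctional_apply,
    ← hm.invariant s⁻¹ (toLinfty μ (Φ.compLeftContinuousBounded G (rightOrbit μ f)))]
  congr 1
  refine (leftTranslate_toLinfty μ s⁻¹ _ _ fun t => ?_).symm
  simp only [ContinuousLinearMap.compLeftContinuousBounded_apply, rightOrbit_apply, inv_inv,
    rightTranslate_rightTranslate]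

/-- The convolution `f * h` averages right translates of `f` with the weights of `h`, and the
functional has the same value on each of them. -/
theorem meanFunctional_lam (Φ : Lp ℂ 1 μ →L[ℝ] ℝ) (f : Lp ℂ 1 μ) {h : Lp ℂ 1 μ}
    (hh : IsDensity μ h) : meanFunctional hm Φ (lam μ 1 f h) = meanFunctional hm Φ f := by
  rw [lam_eq_integralSmul_rightOrbit, integralSmul_apply μ (rightOrbit μ f),
    ← ContinuousLinearMap.integral_comp_comm _ (integrable_smul_bounded μ h _)]
  -- The functional is only real-linear, so the weight `h t` must first be recognised as the real
  -- number `‖h t‖`.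
  have : ∫ t, meanFunctional hm Φ (h t • rightOrbit μ f t) ∂μ =
      ∫ t, ‖h t‖ * meanFunctional hm Φ f ∂μ := by
    refine integral_congr_ae ?_
    filter_upwards [hh.ae_eq_norm] with t ht
    rw [ht, Complex.coe_smul, map_smul, rightOrbit_apply, meanFunctional_rightTranslate,
      Complex.norm_real, norm_norm, smul_eq_mul]
  rw [this, integral_mul_const, ← L1.norm_eq_integral_norm, hh.norm_eq, one_mul]

/-- With `e` an approximate unit for both `f` and `g`, the values at `f` and `g` are close to those
at `e * f` and `e * g`, and both of these equal the value at `e`. -/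
theorem meanFunctional_eq_of_isDensity (Φ : Lp ℂ 1 μ →L[ℝ] ℝ) {f g : Lp ℂ 1 μ}
    (hf : IsDensity μ f) (hg : IsDensity μ g) :
    meanFunctional hm Φ f = meanFunctional hm Φ g := by
  set F := meanFunctional hm Φ with hF
  have hlim : Tendsto (fun ε : ℝ => 2 * (‖F‖ * ε)) (𝓝[>] 0) (𝓝 0) := by
    have : Continuous fun ε : ℝ => 2 * (‖F‖ * ε) := by fun_prop
    simpa using (this.tendsto 0).mono_left nhdsWithin_le_nhds
  rw [← sub_eq_zero, ← norm_le_zero_iff]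
  refine ge_of_tendsto hlim (eventually_mem_nhdsWithin.mono fun ε (hε : 0 < ε) => ?_)
  have hnear : ∀ f : Lp ℂ 1 μ, ∀ᶠ s in 𝓝 (1 : G), ‖leftTranslate μ s f - f‖ ≤ ε := fun f => by
    have := (continuous_leftTranslate μ 1 f).tendsto 1
    rw [leftTranslate_one] at this
    filter_upwards [Metric.tendsto_nhds.1 this ε hε] with s hs
    rw [← dist_eq_norm]
    exact hs.le
  obtain ⟨e, he, heU⟩ := exists_isDensity_of_mem_nhds μ ((hnear f).and (hnear g))
  have h1 : ‖lam μ 1 e f - f‖ ≤ ε := he.norm_integral_smul_sub_le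
    (integrable_smul_leftTranslate μ 1 e f) f (heU.mono fun s hs h0 => (hs h0).1)
  have h2 : ‖lam μ 1 e g - g‖ ≤ ε := he.norm_integral_smul_sub_le
    (integrable_smul_leftTranslate μ 1 e g) g (heU.mono fun s hs h0 => (hs h0).2)
  have e1 : F f - F g = F (lam μ 1 e g - g) - F (lam μ 1 e f - f) := by
    rw [map_sub, map_sub, meanFunctional_lam hm Φ e hf, meanFunctional_lam hm Φ e hg]
    ring
  rw [e1]
  calc _ ≤ ‖F (lam μ 1 e g - g)‖ + ‖F (lam μ 1 e f - f)‖ := norm_sub_le _ _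
    _ ≤ ‖F‖ * ε + ‖F‖ * ε := by
        gcongr
        · exact F.le_opNorm_of_le h2
        · exact F.le_opNorm_of_le h1
    _ = _ := by ring

/-- Day's convexity argument. The tuples `((u j - k) * g)_j`, with `g` a density, form a convex set.
If its closure missed zero, a real functional would exceed some `δ > 0` on it, hence along the orbit
`t ↦ ((u j - k) * δ_t)_j`. The mean of that orbit function would be at least `δ`, yet it vanishes
because mean functionals do not distinguish densities. -/
theorem IsInvariantMean.exists_isDensity_norm_lam_sub_lt {ι : Type*} [Fintype ι]
    {u : ι → Lp ℂ 1 μ} (hu : ∀ j, IsDensity μ (u j)) {k : Lp ℂ 1 μ} (hk : IsDensity μ k)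
    {ε : ℝ} (hε : 0 < ε) :
    ∃ g : Lp ℂ 1 μ, IsDensity μ g ∧ ∀ j, ‖lam μ 1 (u j) g - lam μ 1 k g‖ < ε := by
  classical
  let T : Lp ℂ 1 μ →L[ℝ] ι → Lp ℂ 1 μ :=
    ContinuousLinearMap.pi fun j => (lam μ 1 (u j - k)).restrictScalars ℝ
  have hT : ∀ g j, T g j = lam μ 1 (u j - k) g := fun g j => rfl
  set C := T '' {g | IsDensity μ g} with hC
  suffices h0 : (0 : ι → Lp ℂ 1 μ) ∈ closure C by
    obtain ⟨_, ⟨g, hg, rfl⟩, hdist⟩ := Metric.mem_closure_iff.1 h0 ε hε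
    refine ⟨g, hg, fun j => ?_⟩
    rw [dist_zero_left] at hdist
    have := (norm_le_pi_norm (T g) j).trans_lt hdist
    rwa [hT, map_sub, _root_.sub_apply] at this
  by_contra h0
  have hconv : Convex ℝ C := convex_isDensity.linear_image T.toLinearMap
  obtain ⟨Φ, δ, hδ0, hδ⟩ := geometric_hahn_banach_point_closed hconv.closure isClosed_closure h0
  rw [map_zero] at hδ0
  -- Point masses are not densities, but `(u j - k) * δ_t` is the limit of `(u j - k) * e` as `e`
  -- concentrates at `t`.
  have horb : ∀ t, (fun j => rightTranslate μ t (u j - k)) ∈ closure C := by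
    intro t
    refine Metric.mem_closure_iff.2 fun η hη => ?_
    have hnear : ∀ᶠ s in 𝓝 t, ∀ j, ‖rightTranslate μ s (u j - k) -
        rightTranslate μ t (u j - k)‖ ≤ η / 2 := by
      refine eventually_all.2 fun j => ?_
      filter_upwards [Metric.tendsto_nhds.1
        ((continuous_rightTranslate μ (u j - k)).tendsto t) (η / 2) (by positivity)] with s hs
      rw [← dist_eq_norm]
      exact hs.le
    obtain ⟨e, he, heU⟩ := exists_isDensity_of_mem_nhds μ hnear
    refine ⟨T e, mem_image_of_mem _ he, ?_⟩
    rw [dist_comm, dist_eq_norm]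
    refine ((pi_norm_le_iff_of_nonneg (by positivity)).2 fun j => ?_).trans_lt (half_lt_self hη)
    rw [Pi.sub_apply, hT, lam_eq_integralSmul_rightOrbit, integralSmul_apply]
    exact he.norm_integral_smul_sub_le (integrable_smul_bounded μ e _) _
      (heU.mono fun s hs h0 => hs h0 j)
  let Ψ : ι → Lp ℂ 1 μ →L[ℝ] ℝ := fun j =>
    Φ.comp (ContinuousLinearMap.single ℝ (fun _ : ι => Lp ℂ 1 μ) j)
  have hΨ : ∀ x : ι → Lp ℂ 1 μ, Φ x = ∑ j, Ψ j (x j) := fun x => by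
    conv_lhs => rw [← Finset.univ_sum_single x, _root_.map_sum]
    rfl
  set ψ : G →ᵇ ℝ := ∑ j, (Ψ j).compLeftContinuousBounded G (rightOrbit μ (u j - k)) with hψ
  have hψt : ∀ t, δ ≤ ψ t := fun t => by
    have := hδ _ (horb t)
    rw [hΨ] at this
    rw [hψ, BoundedContinuousFunction.coe_sum, Finset.sum_apply]
    exact this.le
  have h1 := hm.le_apply hψt
  have h2 : m (toLinfty μ ψ) = 0 := by
    rw [hψ, _root_.map_sum, _root_.map_sum]
    refine Finset.sum_eq_zero fun j _ => ?_
    rw [← meanFunctional_apply hm, map_sub, sub_eq_zero]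
    exact meanFunctional_eq_of_isDensity hm _ (hu j) hk
  linarith

/-- Reiter's property `(P₁)`. -/
theorem IsInvariantMean.exists_isDensity_norm_leftTranslate_sub_lt {K : Set G} (hK : IsCompact K)
    {ε : ℝ} (hε : 0 < ε) :
    ∃ g : Lp ℂ 1 μ, IsDensity μ g ∧ ∀ s ∈ K, ‖leftTranslate μ s g - g‖ < ε := by
  obtain ⟨k, hk, -⟩ := exists_isDensity_of_mem_nhds μ (t := 1) univ_mem
  -- Convolving with `k` smooths: `L_t (k * g) = (L_t k) * g` and `t ↦ L_t k` is norm continuous, so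
  -- finitely many translates of `k` control all of `K`, whatever the density `g` is.
  obtain ⟨S, -, hS⟩ := hK.elim_nhds_subcover
    (fun s => {t | ‖leftTranslate μ t k - leftTranslate μ s k‖ < ε / 2}) fun s _ => by
      filter_upwards [Metric.tendsto_nhds.1 ((continuous_leftTranslate μ 1 k).tendsto s) (ε / 2)
        (by positivity)] with t ht
      rwa [← dist_eq_norm]
  obtain ⟨g, hg, hgS⟩ := hm.exists_isDensity_norm_lam_sub_lt
    (u := fun s : S => leftTranslate μ (s : G) k) (fun s => hk.translate s) hk (half_pos hε)
  refine ⟨lam μ 1 k g, hk.convolve hg, fun t ht => ?_⟩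
  obtain ⟨s, hsS, hs⟩ := mem_iUnion₂.1 (hS ht)
  rw [leftTranslate_lam]
  calc ‖lam μ 1 (leftTranslate μ t k) g - lam μ 1 k g‖
      = ‖lam μ 1 (leftTranslate μ t k - leftTranslate μ s k) g +
          (lam μ 1 (leftTranslate μ s k) g - lam μ 1 k g)‖ := by
        rw [map_sub, _root_.sub_apply, sub_add_sub_cancel]
    _ ≤ ‖leftTranslate μ t k - leftTranslate μ s k‖ * ‖g‖ + _ :=
        (norm_add_le _ _).trans (add_le_add_left (norm_lam_le μ _ _) _)
    _ < ε / 2 + ε / 2 := by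
        rw [hg.norm_eq, mul_one]
        exact add_lt_add hs (hgS ⟨s, hsS⟩)
    _ = ε := add_halves ε

end Mean
-- Roots of almost invariant densities and the bound `|∫ f| ≤ ‖λ_r(f)‖`
-- Subadditivity of `x ↦ x ^ c` for `c ≤ 1`.
theorem abs_rpow_sub_rpow_le {a b c : ℝ} (ha : 0 ≤ a) (hb : 0 ≤ b) (hc0 : 0 ≤ c) (hc1 : c ≤ 1) :
    |a ^ c - b ^ c| ≤ |a - b| ^ c := by
  wlog hab : b ≤ a generalizing a b
  · rw [abs_sub_comm, abs_sub_comm a]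
    exact this hb ha (not_le.1 hab).le
  have h0 : 0 ≤ a - b := sub_nonneg.2 hab
  rw [abs_of_nonneg h0, abs_of_nonneg (sub_nonneg.2 (Real.rpow_le_rpow hb hab hc0))]
  have h1 := NNReal.rpow_add_le_add_rpow ⟨b, hb⟩ ⟨a - b, h0⟩ hc0 hc1
  have h2 : (b + (a - b)) ^ c ≤ b ^ c + (a - b) ^ c := by exact_mod_cast h1
  rw [add_sub_cancel] at h2
  linarith

section Root
variable {G : Type*} [Group G] [TopologicalSpace G] [IsTopologicalGroup G]
  [LocallyCompactSpace G] [T2Space G] [MeasurableSpace G] [BorelSpace G]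
variable (μ : Measure G) [μ.IsHaarMeasure] [μ.Regular]
variable (r : ℝ≥0∞) [Fact (1 ≤ r)] [Fact (r ≠ ∞)]

theorem eLpNorm_norm_rpow_toReal_inv (f : G → ℂ) :
    eLpNorm (fun x => ‖f x‖ ^ r.toReal⁻¹) r μ = eLpNorm f 1 μ ^ r.toReal⁻¹ := by
  have h1 : 1 ≤ r := Fact.out
  have ht : r ≠ ∞ := Fact.out
  have hr : 0 < r.toReal := ENNReal.toReal_pos (zero_lt_one.trans_le h1).ne' ht
  have := eLpNorm_norm_rpow (p := r) (μ := μ) f (inv_pos.2 hr)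
  rwa [ENNReal.ofReal_inv_of_pos hr, ENNReal.ofReal_toReal ht,
    ENNReal.mul_inv_cancel (zero_lt_one.trans_le h1).ne' ht] at this

theorem memLp_norm_rpow_toReal_inv (f : Lp ℂ 1 μ) :
    MemLp (fun x => ((‖f x‖ ^ r.toReal⁻¹ : ℝ) : ℂ)) r μ := by
  refine ⟨(Complex.measurable_ofReal.comp_aemeasurable
    ((Lp.aestronglyMeasurable f).aemeasurable.norm.pow_const _)).aestronglyMeasurable, ?_⟩
  rw [eLpNorm_congr_norm_ae (g := fun x => ‖f x‖ ^ r.toReal⁻¹) (ae_of_all _ fun x => by simp),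
    eLpNorm_norm_rpow_toReal_inv]
  exact ENNReal.rpow_lt_top_of_nonneg (by positivity) (Lp.eLpNorm_ne_top f)

/-- The function `|f|^{1/r} ∈ L^r(G)` for `f ∈ L¹(G)`. -/
noncomputable def rootLp (f : Lp ℂ 1 μ) : Lp ℂ r μ := (memLp_norm_rpow_toReal_inv μ r f).toLp _

theorem norm_rootLp (f : Lp ℂ 1 μ) : ‖rootLp μ r f‖ = ‖f‖ ^ r.toReal⁻¹ := by
  rw [rootLp, Lp.norm_toLp, eLpNorm_congr_norm_ae (g := fun x => ‖f x‖ ^ r.toReal⁻¹)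
    (ae_of_all _ fun x => by simp), eLpNorm_norm_rpow_toReal_inv, ← ENNReal.toReal_rpow,
    Lp.norm_def]

/-- Pointwise, `||a|^{1/r} - |b|^{1/r}|^r ≤ |a - b|`; integrating transfers almost invariance from
`L¹` to `L^r`. -/
theorem norm_leftTranslate_rootLp_sub_le (s : G) (f : Lp ℂ 1 μ) :
    ‖leftTranslate μ s (rootLp μ r f) - rootLp μ r f‖ ≤
      ‖leftTranslate μ s f - f‖ ^ r.toReal⁻¹ := by
  have h1 : 1 ≤ r := Fact.out
  have hr : 1 ≤ r.toReal := by
    simpa using ENNReal.toReal_mono (Fact.out : r ≠ ∞) h1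
  rw [Lp.norm_def, Lp.norm_def (leftTranslate μ s f - f), ENNReal.toReal_rpow,
    ← eLpNorm_norm_rpow_toReal_inv]
  have hfin : eLpNorm (fun x => ‖(leftTranslate μ s f - f) x‖ ^ r.toReal⁻¹) r μ ≠ ∞ := by
    rw [eLpNorm_norm_rpow_toReal_inv]
    exact ENNReal.rpow_ne_top_of_nonneg (by positivity) (Lp.eLpNorm_ne_top _)
  refine ENNReal.toReal_mono hfin (eLpNorm_mono_ae ?_)
  have hroot := (memLp_norm_rpow_toReal_inv μ r f).coeFn_toLp
  filter_upwards [Lp.coeFn_sub (leftTranslate μ s (rootLp μ r f)) (rootLp μ r f),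
    Lp.coeFn_sub (leftTranslate μ s f) f, leftTranslate_ae_eq μ s f,
    leftTranslate_ae_eq μ s (rootLp μ r f), hroot,
    (measurePreserving_mul_left μ s⁻¹).quasiMeasurePreserving.ae hroot] with x e1 e2 e3 e4 e5 e6
  rw [e1, e2, Pi.sub_apply, Pi.sub_apply, e3, e4, rootLp, e5, e6, ← Complex.ofReal_sub,
    Complex.norm_real, Real.norm_of_nonneg (by positivity : 0 ≤ ‖f (s⁻¹ * x) - f x‖ ^ r.toReal⁻¹)]
  refine (abs_rpow_sub_rpow_le (norm_nonneg _) (norm_nonneg _) (by positivity)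
    (inv_le_one_of_one_le₀ hr)).trans ?_
  gcongr
  exact abs_norm_sub_norm_le _ _

variable {μ}

/-- On an amenable group the trivial representation is contractive for the `B(L^r(G))`-norm. -/
theorem IsInvariantMean.norm_totalIntegral_le_norm_lam {m : Lp ℝ ∞ μ →ₗ[ℝ] ℝ}
    (hm : IsInvariantMean μ m) (f : Lp ℂ 1 μ) : ‖totalIntegral μ f‖ ≤ ‖lam μ r f‖ := by
  -- Both sides are continuous in the `L¹`-norm. Compact support is needed because Reiter's property
  -- controls translates over compact sets only.
  refine L1_induction_of_hasCompactSupport μ (P := fun f => ‖totalIntegral μ f‖ ≤ ‖lam μ r f‖)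
    (isClosed_le (by fun_prop) (by fun_prop)) (fun φ hφ hφs hφL => ?_) f
  set f := hφL.toLp φ with hf
  have h1 : 1 ≤ r := Fact.out
  have hr : 0 < r.toReal := ENNReal.toReal_pos (zero_lt_one.trans_le h1).ne' Fact.out
  have hlim : Tendsto (fun ε : ℝ => ‖lam μ r f‖ + ‖f‖ * ε) (𝓝[>] 0) (𝓝 ‖lam μ r f‖) := by
    have : Continuous fun ε : ℝ => ‖lam μ r f‖ + ‖f‖ * ε := by fun_prop
    simpa using (this.tendsto 0).mono_left nhdsWithin_le_nhds
  refine ge_of_tendsto hlim (eventually_mem_nhdsWithin.mono fun ε (hε : 0 < ε) => ?_)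
  -- The tolerance `ε ^ r` becomes `ε` after passing to `r`-th roots.
  obtain ⟨g, hg, hgK⟩ := hm.exists_isDensity_norm_leftTranslate_sub_lt hφs.isCompact
    (Real.rpow_pos_of_pos hε r.toReal)
  set u := rootLp μ r g with hu
  have hu1 : ‖u‖ = 1 := by rw [hu, norm_rootLp, hg.norm_eq, Real.one_rpow]
  have hK : ∀ s ∈ tsupport φ, ‖leftTranslate μ s u - u‖ ≤ ε := fun s hs => by
    refine (norm_leftTranslate_rootLp_sub_le μ r s g).trans ?_
    refine (Real.rpow_le_rpow (norm_nonneg _) (hgK s hs).le (by positivity)).trans_eq ?_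
    rw [← Real.rpow_mul hε.le, mul_inv_cancel₀ hr.ne', Real.rpow_one]
  have hi := L1.integrable_coeFn f
  -- The unit vector `u` is an approximate eigenvector of `λ_r(f)` with eigenvalue `∫ f`.
  have hdiff : ‖lam μ r f u - totalIntegral μ f • u‖ ≤ ‖f‖ * ε := by
    rw [lam_apply, totalIntegral_apply, ← integral_smul_const,
      ← integral_sub (integrable_smul_leftTranslate μ r f u) (hi.smul_const u),
      L1.norm_eq_integral_norm, ← integral_mul_const]
    refine norm_integral_le_of_norm_le (hi.norm.mul_const _) ?_
    filter_upwards [hφL.coeFn_toLp] with s hs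
    rw [← smul_sub, norm_smul]
    by_cases hsK : s ∈ tsupport φ
    · gcongr
      exact hK s hsK
    · rw [hf, hs, image_eq_zero_of_notMem_tsupport hsK]
      simp
  calc ‖totalIntegral μ f‖ = ‖totalIntegral μ f • u‖ := by rw [norm_smul, hu1, mul_one]
    _ ≤ ‖lam μ r f u‖ + ‖lam μ r f u - totalIntegral μ f • u‖ := norm_le_norm_add_norm_sub _ _
    _ ≤ ‖lam μ r f‖ + ‖f‖ * ε := by
        gcongr
        simpa [hu1] using (lam μ r f).le_opNorm u

end Root

/-! ### The trivial representation on `PF_p^*(G)`: extension and contractivity -/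

section Extension
open UniformSpace
variable {G : Type*} [Group G] [TopologicalSpace G] [IsTopologicalGroup G]
  [LocallyCompactSpace G] [T2Space G] [MeasurableSpace G] [BorelSpace G]
variable (μ : Measure G) [μ.IsHaarMeasure] [μ.Regular] (p : ℝ≥0∞) [Fact (1 < p)] [Fact (p < ∞)]

/-- The integral on `L¹(G)` normed by the `PF_p^*(G)`-norm. -/
noncomputable def totalIntegralPF : L1PF μ p →ₗ[ℂ] ℂ := (totalIntegral μ).toLinearMap

theorem exists_starAlgHom_of_norm_le (h : ∀ f : L1PF μ p, ‖totalIntegralPF μ p f‖ ≤ ‖f‖) :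
    ∃ π : PFStar μ p →⋆ₙₐ[ℂ] ℂ, ∀ f : Lp ℂ 1 μ, π (PFStar.of μ p f) = ∫ s, f s ∂μ := by
  have hu : UniformContinuous (totalIntegralPF μ p) :=
    (totalIntegralPF μ p).mkContinuous 1 (by simpa using h) |>.uniformContinuous
  set π : PFStar μ p → ℂ := Completion.extension (totalIntegralPF μ p) with hπ
  have hc : Continuous π := Completion.continuous_extension
  have hcoe : ∀ f : L1PF μ p, π (f : PFStar μ p) = totalIntegralPF μ p f :=
    Completion.extension_coe hu
  refine ⟨{ toFun := π, map_smul' := ?_, map_zero' := ?_, map_add' := ?_, map_mul' := ?_,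
            map_star' := ?_ }, fun f => (hcoe f).trans (totalIntegral_apply μ f)⟩
  · intro c a
    refine Completion.induction_on a (isClosed_eq ?_ ?_) fun a => ?_
    · exact hc.comp (continuous_id.const_smul c)
    · exact hc.const_smul c
    · rw [← Completion.coe_smul c a, hcoe, hcoe]
      exact map_smul (totalIntegralPF μ p) c a
  · show π 0 = 0
    rw [← Completion.coe_zero, hcoe, map_zero]
  · intro a b
    refine Completion.induction_on₂ a b (isClosed_eq ?_ ?_) fun a b => ?_
    · exact hc.comp continuous_add
    · exact (hc.comp continuous_fst).add (hc.comp continuous_snd)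
    · show π (a + b) = π a + π b
      rw [← Completion.coe_add, hcoe, hcoe, hcoe, map_add]
  · intro a b
    refine Completion.induction_on₂ a b (isClosed_eq ?_ ?_) fun a b => ?_
    · exact hc.comp continuous_mul
    · exact (hc.comp continuous_fst).mul (hc.comp continuous_snd)
    · show π (a * b) = π a * π b
      rw [← PFStar.coe_mul, hcoe, hcoe, hcoe]
      exact totalIntegral_lam μ a b
  · intro a
    refine Completion.induction_on a (isClosed_eq ?_ ?_) fun a => ?_
    · exact hc.comp continuous_star
    · exact hc.star
    · show π (star (a : PFStar μ p)) = star (π a)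
      rw [← PFStar.coe_star, hcoe, hcoe]
      exact totalIntegral_invol μ a

theorem IsAmenable.exists_starAlgHom (h : IsAmenable μ) :
    ∃ π : PFStar μ p →⋆ₙₐ[ℂ] ℂ, ∀ f : Lp ℂ 1 μ, π (PFStar.of μ p f) = ∫ s, f s ∂μ := by
  obtain ⟨m, h1, h2, h3⟩ := h
  have hm : IsInvariantMean μ m := ⟨h1, h2, h3⟩
  exact exists_starAlgHom_of_norm_le μ p fun f =>
    (hm.norm_totalIntegral_le_norm_lam p f).trans (le_max_left _ _)

/-- A `*`-representation of `PF_p^*(G)` on `ℂ` is contractive. -/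
theorem norm_starAlgHom_apply_le (π : PFStar μ p →⋆ₙₐ[ℂ] ℂ) (a : PFStar μ p) : ‖π a‖ ≤ ‖a‖ := by
  by_contra! hlt
  have h0 : π a ≠ 0 := norm_pos_iff.1 ((norm_nonneg a).trans_lt hlt)
  -- Now `π b = 1` while `‖b‖ < 1`, so `x = b + b * x` has a solution by completeness; applying `π`
  -- gives `π x = 1 + π x`.
  set b : PFStar μ p := (π a)⁻¹ • a with hb
  have hb1 : π b = 1 := by rw [hb, map_smul, smul_eq_mul, inv_mul_cancel₀ h0]
  have hbn : ‖b‖ < 1 := by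
    rw [hb, norm_smul, norm_inv, inv_mul_lt_one₀ (norm_pos_iff.2 h0)]
    exact hlt
  have hcontr : ContractingWith ‖b‖₊ fun x : PFStar μ p => b + b * x := by
    refine ⟨hbn, LipschitzWith.of_dist_le_mul fun x y => ?_⟩
    rw [dist_add_left, dist_eq_norm, ← mul_sub, dist_eq_norm]
    exact norm_mul_le b (x - y)
  have hfix := hcontr.fixedPoint_isFixedPt
  have := congrArg π hfix.eq
  rw [map_add, map_mul, hb1, one_mul] at this
  exact one_ne_zero (add_eq_right.1 this)

/-- The density `g = f^* * f` satisfies `λ_p(g^*) = λ_p(g)`, and the involution exchanges the roles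
of `p` and `q`, so `‖λ_q(g)‖ ≤ ‖λ_p(g)‖` and the maximum is its first entry. Hence `1 ≤ ‖λ_p(g)‖ ≤
‖λ_p(f^*)‖ ‖λ_p(f)‖ ≤ ‖λ_p(f)‖`. -/
theorem one_le_norm_lam_of_isDensity (h : ∀ f : Lp ℂ 1 μ, ‖totalIntegral μ f‖ ≤
      max ‖lam μ p f‖ ‖lam μ p.conjExponent f‖) {f : Lp ℂ 1 μ} (hf : IsDensity μ f) :
    1 ≤ ‖lam μ p f‖ := by
  set q := p.conjExponent
  have hle : ∀ r : ℝ≥0∞, ∀ [Fact (1 ≤ r)] [Fact (r ≠ ∞)], ∀ f : Lp ℂ 1 μ, ‖lam μ r f‖ ≤ ‖f‖ := by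
    intro r _ _ f
    refine ContinuousLinearMap.opNorm_le_bound _ (norm_nonneg _) fun g => ?_
    rw [lam_apply, L1.norm_eq_integral_norm f, ← integral_mul_const]
    refine norm_integral_le_of_norm_le ((L1.integrable_coeFn f).norm.mul_const _)
      (ae_of_all _ fun s => ?_)
    rw [norm_smul, norm_leftTranslate]
  set g := lam μ 1 (invol μ f) f with hg
  have hgd : IsDensity μ g := hf.invol.convolve hf
  have hgg : ‖lam μ p (invol μ g)‖ = ‖lam μ p g‖ := by
    rw [hg, lam_invol_lam μ p q, invol_invol]
  have hqp : ‖lam μ q g‖ ≤ ‖lam μ p g‖ := by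
    have := norm_lam_invol_le μ q p (invol μ g)
    rwa [invol_invol, hgg] at this
  have h1 := h g
  rw [hgd.2, norm_one, max_eq_left hqp] at h1
  have hcomp : lam μ p g =
      (lam μ p (invol μ f)).comp (lam μ p f) :=
    ContinuousLinearMap.ext fun u => lam_lam μ p _ _ u
  rw [hcomp] at h1
  refine h1.trans ((ContinuousLinearMap.opNorm_comp_le _ _).trans ?_)
  refine mul_le_of_le_one_left (norm_nonneg _) ((hle p _).trans hf.invol.1)

end Extension
-- Stability of Young's inequality and almost norm-attaining pairs
/-- A quantitative form of the weighted arithmetic-geometric mean inequality. -/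
theorem min_mul_sq_sqrt_sub_sqrt_le {a b θ θ' : ℝ} (ha : 0 ≤ a) (hb : 0 ≤ b) (hθ : 0 ≤ θ)
    (hθ' : 0 ≤ θ') (h1 : θ + θ' = 1) :
    min θ θ' * (√a - √b) ^ 2 ≤ θ * a + θ' * b - a ^ θ * b ^ θ' := by
  wlog hle : θ ≤ θ' generalizing a b θ θ'
  · have := this hb ha hθ' hθ (by linarith) (by linarith)
    rw [min_comm, mul_comm (a ^ θ), ← neg_sub √b, neg_sq]
    linarith
  rw [min_eq_left hle]
  -- Here `a ^ θ * b ^ θ'` is the mean of `b` and `√(ab)` with weights `θ' - θ` and `2θ`. The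
  -- inequality for these two numbers falls short of the one for `a`, `b` by exactly `θ (√a - √b)²`.
  have key := Real.geom_mean_le_arith_mean2_weighted (w₁ := θ' - θ) (w₂ := 2 * θ) (p₁ := b)
    (p₂ := √a * √b) (by linarith) (by linarith) hb (by positivity) (by linarith)
  have e1 : b ^ (θ' - θ) * (√a * √b) ^ (2 * θ) = a ^ θ * b ^ θ' := by
    rw [← Real.sqrt_mul ha, Real.rpow_mul (Real.sqrt_nonneg _), Real.rpow_two,
      Real.sq_sqrt (mul_nonneg ha hb), Real.mul_rpow ha hb, mul_left_comm,
      ← Real.rpow_add_of_nonneg hb (by linarith) hθ, sub_add_cancel]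
  rw [e1] at key
  have e2 : (√a - √b) ^ 2 = a + b - 2 * (√a * √b) := by
    rw [sub_sq, Real.sq_sqrt ha, Real.sq_sqrt hb]
    ring
  rw [e2]
  linarith

/-- If Young's inequality is almost an equality for `u` and `v`, then `u ^ P` is close to
`v ^ Q`. -/
theorem abs_rpow_sub_rpow_le_young {P Q : ℝ} (hPQ : P.HolderConjugate Q) {η : ℝ} (hη : 0 < η)
    {u v : ℝ} (hu : 0 ≤ u) (hv : 0 ≤ v) :
    |u ^ P - v ^ Q| ≤ (2 * min P⁻¹ Q⁻¹ * η)⁻¹ * (P⁻¹ * u ^ P + Q⁻¹ * v ^ Q - u * v) +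
      η * (u ^ P + v ^ Q) := by
  have hP := hPQ.inv_pos
  have hQ := hPQ.symm.inv_pos
  set a := u ^ P with ha
  set b := v ^ Q with hb
  have ha0 : 0 ≤ a := by positivity
  have hb0 : 0 ≤ b := by positivity
  have h1 := min_mul_sq_sqrt_sub_sqrt_le ha0 hb0 hP.le hQ.le hPQ.inv_add_inv_eq_one
  have e1 : a ^ P⁻¹ = u := by rw [ha, Real.rpow_rpow_inv hu hPQ.ne_zero]
  have e2 : b ^ Q⁻¹ = v := by rw [hb, Real.rpow_rpow_inv hv hPQ.symm.ne_zero]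
  rw [e1, e2] at h1
  have hκ : 0 < min P⁻¹ Q⁻¹ := lt_min hP hQ
  set κ := min P⁻¹ Q⁻¹
  have h2 : (√a - √b) ^ 2 ≤ κ⁻¹ * (P⁻¹ * a + Q⁻¹ * b - u * v) := by
    rw [← div_eq_inv_mul, le_div_iff₀ hκ]
    linarith
  -- The product is split with weight `η`: the square of the first factor is controlled by the
  -- defect in Young's inequality, the second factor is merely bounded.
  have h3 : |a - b| = |√a - √b| * (√a + √b) := by
    rw [← abs_of_nonneg (by positivity : 0 ≤ √a + √b), ← abs_mul]
    congr 1
    nlinarith [Real.sq_sqrt ha0, Real.sq_sqrt hb0]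
  have h4 : |√a - √b| * (√a + √b) ≤ (2 * η)⁻¹ * (√a - √b) ^ 2 + η * (a + b) := by
    have h5 : (√a + √b) ^ 2 ≤ 2 * (a + b) := by
      nlinarith [Real.sq_sqrt ha0, Real.sq_sqrt hb0, sq_nonneg (√a - √b)]
    have h6 : |√a - √b| * (√a + √b) ≤
        (2 * η)⁻¹ * (√a - √b) ^ 2 + η / 2 * (√a + √b) ^ 2 := by
      have h7 : (2 * η)⁻¹ * (√a - √b) ^ 2 + η / 2 * (√a + √b) ^ 2 - |√a - √b| * (√a + √b) =
          (2 * η)⁻¹ * (|√a - √b| - η * (√a + √b)) ^ 2 := by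
        rw [← sq_abs (√a - √b)]
        field_simp
        ring
      have : 0 ≤ (2 * η)⁻¹ * (|√a - √b| - η * (√a + √b)) ^ 2 := by positivity
      linarith
    nlinarith
  rw [h3]
  have h5 : (2 * η)⁻¹ * (√a - √b) ^ 2 ≤ (2 * κ * η)⁻¹ * (P⁻¹ * a + Q⁻¹ * b - u * v) := by
    refine (mul_le_mul_of_nonneg_left h2 (by positivity)).trans_eq ?_
    rw [← mul_assoc, ← mul_inv]
    congr 2
    ring
  linarith

section Power
variable {G : Type*} [Group G] [TopologicalSpace G] [IsTopologicalGroup G]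
  [LocallyCompactSpace G] [T2Space G] [MeasurableSpace G] [BorelSpace G]
variable (μ : Measure G) [μ.IsHaarMeasure] [μ.Regular]
variable (p : ℝ≥0∞) [Fact (1 ≤ p)] [Fact (p ≠ ∞)]

theorem integrable_norm_rpow_Lp (g : Lp ℂ p μ) : Integrable (fun x => ‖g x‖ ^ p.toReal) μ :=
  (Lp.memLp g).integrable_norm_rpow (zero_lt_one.trans_le Fact.out).ne' Fact.out

/-- The function `|g|^p ∈ L¹(G)` for `g ∈ L^p(G)`. -/
noncomputable def powLp (g : Lp ℂ p μ) : Lp ℂ 1 μ :=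
  Integrable.toL1 (fun x => ((‖g x‖ ^ p.toReal : ℝ) : ℂ)) (integrable_norm_rpow_Lp μ p g).ofReal

theorem coeFn_powLp (g : Lp ℂ p μ) :
    powLp μ p g =ᵐ[μ] fun x => ((‖g x‖ ^ p.toReal : ℝ) : ℂ) := Integrable.coeFn_toL1 _

theorem integral_norm_rpow_Lp (g : Lp ℂ p μ) :
    ∫ x, ‖g x‖ ^ p.toReal ∂μ = ‖g‖ ^ p.toReal := by
  have h1 : 1 ≤ p := Fact.out
  have ht : p ≠ ∞ := Fact.out
  have h0 : p ≠ 0 := (zero_lt_one.trans_le h1).ne'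
  rw [Lp.norm_def, (Lp.memLp g).eLpNorm_eq_integral_rpow_norm h0 ht,
    ENNReal.toReal_ofReal (by positivity), ← Real.rpow_mul (by positivity),
    inv_mul_cancel₀ (ENNReal.toReal_pos h0 ht).ne', Real.rpow_one]

theorem isDensity_powLp {g : Lp ℂ p μ} (hg : ‖g‖ = 1) : IsDensity μ (powLp μ p g) := by
  have h1 : ∫ x, ‖g x‖ ^ p.toReal ∂μ = 1 := by
    rw [integral_norm_rpow_Lp, hg, Real.one_rpow]
  refine ⟨le_of_eq ?_, ?_⟩
  · rw [L1.norm_eq_integral_norm, ← h1]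
    refine integral_congr_ae ?_
    filter_upwards [coeFn_powLp μ p g] with x hx
    rw [hx, Complex.norm_real, Real.norm_of_nonneg (by positivity)]
  · rw [totalIntegral_apply, integral_congr_ae (coeFn_powLp μ p g), integral_complex_ofReal, h1,
      Complex.ofReal_one]

theorem leftTranslate_powLp (s : G) (g : Lp ℂ p μ) :
    leftTranslate μ s (powLp μ p g) = powLp μ p (leftTranslate μ s g) := by
  refine Lp.ext ?_
  filter_upwards [leftTranslate_ae_eq μ s (powLp μ p g), leftTranslate_ae_eq μ s g,
    coeFn_powLp μ p (leftTranslate μ s g),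
    (measurePreserving_mul_left μ s⁻¹).quasiMeasurePreserving.ae (coeFn_powLp μ p g)]
    with x h1 h2 h3 h4
  rw [h1, h3, h4, h2]

variable (q : ℝ≥0∞) [Fact (1 ≤ q)] [Fact (q ≠ ∞)] [p.HolderConjugate q]

/-- If `⟨g, h⟩` is almost `1` for unit vectors `g ∈ L^p`, `h ∈ L^q`, then `|g|^p` is close to
`|h|^q` in `L¹`. -/
theorem norm_powLp_sub_powLp_le {η : ℝ} (hη : 0 < η) {g : Lp ℂ p μ} {h : Lp ℂ q μ}
    (hg : ‖g‖ = 1) (hh : ‖h‖ = 1) :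
    ‖powLp μ p g - powLp μ q h‖ ≤ (2 * min p.toReal⁻¹ q.toReal⁻¹ * η)⁻¹ *
      (1 - (pairing μ p q h g).re) + 2 * η := by
  have hpq : p.HolderConjugate q := inferInstance
  have hPQ : p.toReal.HolderConjugate q.toReal :=
    ENNReal.HolderConjugate.toReal_of_ne_top Fact.out Fact.out
  set P := p.toReal
  set Q := q.toReal
  set c := (2 * min P⁻¹ Q⁻¹ * η)⁻¹ with hc
  have hc0 : 0 ≤ c := by
    have := hPQ.inv_pos
    have := hPQ.symm.inv_pos
    positivity
  have hgi := integrable_norm_rpow_Lp μ p g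
  have hhi := integrable_norm_rpow_Lp μ q h
  have hgh : Integrable (fun x => ‖g x‖ * ‖h x‖) μ :=
    (Lp.memLp g).norm.integrable_mul (Lp.memLp h).norm
  have hg1 : ∫ x, ‖g x‖ ^ P ∂μ = 1 := by rw [integral_norm_rpow_Lp, hg, Real.one_rpow]
  have hh1 : ∫ x, ‖h x‖ ^ Q ∂μ = 1 := by rw [integral_norm_rpow_Lp, hh, Real.one_rpow]
  have hpair : (pairing μ p q h g).re ≤ ∫ x, ‖g x‖ * ‖h x‖ ∂μ := by
    refine (Complex.re_le_norm _).trans ?_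
    rw [pairing_apply]
    refine norm_integral_le_of_norm_le hgh (ae_of_all _ fun x => ?_)
    rw [norm_mul, RCLike.norm_conj]
  have hyi : Integrable (fun x => P⁻¹ * ‖g x‖ ^ P + Q⁻¹ * ‖h x‖ ^ Q - ‖g x‖ * ‖h x‖) μ :=
    ((hgi.const_mul _).add (hhi.const_mul _)).sub hgh
  have hsi : Integrable (fun x => ‖g x‖ ^ P + ‖h x‖ ^ Q) μ := hgi.add hhi
  -- As `1/P + 1/Q = 1`, the integrated Young defect is `1 - ∫ |g||h|`, which `hpair` bounds by `1 -
  -- Re ⟨g, h⟩`.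
  have hy : ∫ x, (P⁻¹ * ‖g x‖ ^ P + Q⁻¹ * ‖h x‖ ^ Q - ‖g x‖ * ‖h x‖) ∂μ =
      1 - ∫ x, ‖g x‖ * ‖h x‖ ∂μ := by
    have hsum : Integrable (fun x => P⁻¹ * ‖g x‖ ^ P + Q⁻¹ * ‖h x‖ ^ Q) μ :=
      (hgi.const_mul _).add (hhi.const_mul _)
    rw [integral_sub hsum hgh,
      integral_add (hgi.const_mul _) (hhi.const_mul _), integral_const_mul, integral_const_mul,
      hg1, hh1, mul_one, mul_one, hPQ.inv_add_inv_eq_one]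
  calc ‖powLp μ p g - powLp μ q h‖
      ≤ ∫ x, (c * (P⁻¹ * ‖g x‖ ^ P + Q⁻¹ * ‖h x‖ ^ Q - ‖g x‖ * ‖h x‖) +
          η * (‖g x‖ ^ P + ‖h x‖ ^ Q)) ∂μ := by
        rw [L1.norm_eq_integral_norm]
        refine integral_mono_ae (L1.integrable_coeFn _).norm
          ((hyi.const_mul _).add (hsi.const_mul _)) ?_
        filter_upwards [Lp.coeFn_sub (powLp μ p g) (powLp μ q h), coeFn_powLp μ p g,
          coeFn_powLp μ q h] with x h1 h2 h3
        rw [h1, Pi.sub_apply, h2, h3, ← Complex.ofReal_sub, Complex.norm_real]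
        exact abs_rpow_sub_rpow_le_young hPQ hη (norm_nonneg _) (norm_nonneg _)
    _ = c * (1 - ∫ x, ‖g x‖ * ‖h x‖ ∂μ) + 2 * η := by
        rw [integral_add (hyi.const_mul _) (hsi.const_mul _), integral_const_mul,
          integral_const_mul, hy, integral_add hgi hhi, hg1, hh1]
        ring
    _ ≤ _ := by gcongr

/-- Operator norms on `L^p` are detected by pairing with `L^q`. After normalising an almost norming
pair, a unimodular factor on `g` makes the pairing real and positive. -/
theorem exists_unit_re_pairing_gt {T : Lp ℂ p μ →L[ℂ] Lp ℂ p μ} (hT : 1 ≤ ‖T‖) {δ : ℝ}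
    (hδ : 0 < δ) (hδ1 : δ < 1) :
    ∃ (g : Lp ℂ p μ) (h : Lp ℂ q μ), ‖g‖ = 1 ∧ ‖h‖ = 1 ∧ 1 - δ < (pairing μ p q h (T g)).re := by
  have hsymm : q.HolderConjugate p := ENNReal.HolderConjugate.symm
  obtain ⟨x, y, hxy⟩ : ∃ (x : Lp ℂ p μ) (y : Lp ℂ q μ),
      (1 - δ) * ‖x‖ * ‖y‖ < ‖pairing μ p q y (T x)‖ := by
    by_contra! hcon
    have hle : ‖T‖ ≤ 1 - δ := ContinuousLinearMap.opNorm_le_bound _ (by linarith) fun x =>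
      norm_le_of_pairing μ p q _ (mul_nonneg (by linarith) (norm_nonneg _)) (hcon x)
    linarith
  have hx : x ≠ 0 := by rintro rfl; simp at hxy
  have hy : y ≠ 0 := by
    rintro rfl
    rw [pairing_swap μ p q] at hxy
    simp at hxy
  have hx0 : 0 < ‖x‖ := norm_pos_iff.2 hx
  have hy0 : 0 < ‖y‖ := norm_pos_iff.2 hy
  set z := pairing μ p q y (T x) with hz
  have hz0 : z ≠ 0 := by
    rw [← norm_pos_iff]
    refine lt_of_le_of_lt ?_ hxy
    have : 0 < 1 - δ := by linarith
    positivity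
  have hzn : 0 < ‖z‖ := norm_pos_iff.2 hz0
  refine ⟨(conj z / (‖z‖ * ‖x‖) : ℂ) • x, ((‖y‖⁻¹ : ℝ) : ℂ) • y, ?_, ?_, ?_⟩
  · rw [norm_smul, norm_div, RCLike.norm_conj, norm_mul, Complex.norm_real, Complex.norm_real,
      norm_norm, norm_norm]
    field_simp
  · rw [norm_smul, Complex.norm_real, norm_inv, norm_norm, inv_mul_cancel₀ hy0.ne']
  · have e1 : pairing μ p q (((‖y‖⁻¹ : ℝ) : ℂ) • y) (T x) = ((‖y‖⁻¹ : ℝ) : ℂ) * z := by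
      rw [hz, pairing_swap μ p q, map_smul, smul_eq_mul, map_mul, Complex.conj_ofReal,
        ← pairing_swap]
    rw [map_smul, map_smul, smul_eq_mul, e1]
    have e2 : (conj z / (‖z‖ * ‖x‖) : ℂ) * (((‖y‖⁻¹ : ℝ) : ℂ) * z) =
        ((‖z‖ / (‖x‖ * ‖y‖) : ℝ) : ℂ) := by
      have h3 : conj z * z = ((‖z‖ : ℝ) : ℂ) ^ 2 := by
        rw [mul_comm, Complex.mul_conj, Complex.normSq_eq_norm_sq]
        push_cast
        rfl
      have hz' : ((‖z‖ : ℝ) : ℂ) ≠ 0 := by exact_mod_cast hzn.ne'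
      have hx' : ((‖x‖ : ℝ) : ℂ) ≠ 0 := by exact_mod_cast hx0.ne'
      have hy' : ((‖y‖ : ℝ) : ℂ) ≠ 0 := by exact_mod_cast hy0.ne'
      push_cast
      field_simp
      rw [h3]
    rw [e2, Complex.ofReal_re, lt_div_iff₀ (by positivity)]
    linarith

end Power
-- From norms of convolution operators to almost invariant densities
section Reiter
variable {G : Type*} [Group G] [TopologicalSpace G] [IsTopologicalGroup G]
  [LocallyCompactSpace G] [T2Space G] [MeasurableSpace G] [BorelSpace G]
variable (μ : Measure G) [μ.IsHaarMeasure] [μ.Regular]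

/-- The bounded continuous function `s ↦ ‖L_s g - h‖₁`. -/
noncomputable def orbitDist (g h : Lp ℂ 1 μ) : G →ᵇ ℂ :=
  BoundedContinuousFunction.ofNormedAddCommGroup
    (fun s => ((‖leftTranslate μ s g - h‖ : ℝ) : ℂ))
    (Complex.continuous_ofReal.comp ((continuous_leftTranslate μ 1 g).sub continuous_const).norm)
    (‖g‖ + ‖h‖) fun s => by
      rw [Complex.norm_real, norm_norm]
      exact (norm_sub_le _ _).trans_eq (by rw [norm_leftTranslate])

theorem orbitDist_apply (g h : Lp ℂ 1 μ) (s : G) :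
    orbitDist μ g h s = ((‖leftTranslate μ s g - h‖ : ℝ) : ℂ) := rfl

variable {μ}

theorem integrable_norm_mul_norm_leftTranslate_sub (f g h : Lp ℂ 1 μ) :
    Integrable (fun s => ‖f s‖ * ‖leftTranslate μ s g - h‖) μ := by
  refine (integrable_smul_bounded μ f (orbitDist μ g h)).norm.congr (ae_of_all _ fun s => ?_)
  simp only [norm_smul, orbitDist_apply, Complex.norm_real, norm_norm]

/-- Expressing the average distance through a functional linear in `f` allows it to be split when
`f` is a convex combination. -/
theorem IsDensity.re_integralSmul_orbitDist {f : Lp ℂ 1 μ} (hf : IsDensity μ f)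
    (g h : Lp ℂ 1 μ) : (integralSmul μ (orbitDist μ g h) f).re =
      ∫ s, ‖f s‖ * ‖leftTranslate μ s g - h‖ ∂μ := by
  rw [integralSmul_apply, ← Complex.ofReal_re (∫ s, ‖f s‖ * ‖_‖ ∂μ), ← integral_complex_ofReal]
  congr 1
  refine integral_congr_ae ?_
  filter_upwards [hf.ae_eq_norm] with s hs
  rw [hs, orbitDist_apply, smul_eq_mul, Complex.norm_real, norm_norm]
  push_cast
  rfl

theorem IsDensity.norm_lam_sub_le {f : Lp ℂ 1 μ} (hf : IsDensity μ f) (g h : Lp ℂ 1 μ) :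
    ‖lam μ 1 f g - h‖ ≤ (integralSmul μ (orbitDist μ g h) f).re := by
  have hi := L1.integrable_coeFn f
  have h1 : h = ∫ s, f s • h ∂μ := by
    rw [integral_smul_const, ← totalIntegral_apply, hf.2, one_smul]
  rw [hf.re_integralSmul_orbitDist]
  conv_lhs => rw [h1]
  rw [lam_apply, ← integral_sub (integrable_smul_leftTranslate μ 1 f g) (hi.smul_const h)]
  refine norm_integral_le_of_norm_le (integrable_norm_mul_norm_leftTranslate_sub f g h)
    (ae_of_all _ fun s => ?_)
  rw [← smul_sub, norm_smul]

variable (μ)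

/-- If `λ_p(f)` has norm one for a probability density `f`, then there is a probability density
whose translates by `f`-most elements are almost equal. -/
theorem exists_isDensity_orbitDist_le (p : ℝ≥0∞) [Fact (1 ≤ p)] [Fact (p ≠ ∞)]
    (q : ℝ≥0∞) [Fact (1 ≤ q)] [Fact (q ≠ ∞)] [p.HolderConjugate q]
    {f : Lp ℂ 1 μ} (hf : IsDensity μ f)
    (hf1 : 1 ≤ ‖lam μ p f‖) {ε : ℝ} (hε : 0 < ε) :
    ∃ g h : Lp ℂ 1 μ, IsDensity μ g ∧ IsDensity μ h ∧
      (integralSmul μ (orbitDist μ g h) f).re ≤ ε := by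
  have hPQ : p.toReal.HolderConjugate q.toReal :=
    ENNReal.HolderConjugate.toReal_of_ne_top Fact.out Fact.out
  -- The final bound is `c * δ + 2 * η`, so `η` and `δ` are chosen to make each term at most `ε /
  -- 2`. The cap `1 / 2` in `δ` keeps `δ < 1`.
  set η := ε / 4 with hη
  have hη0 : 0 < η := by positivity
  set c := (2 * min p.toReal⁻¹ q.toReal⁻¹ * η)⁻¹ with hc
  have hc0 : 0 < c := by
    have := hPQ.inv_pos
    have := hPQ.symm.inv_pos
    positivity
  set δ := min (1 / 2) (ε / (2 * c)) with hδ
  have hδ0 : 0 < δ := by positivity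
  obtain ⟨u, v, hu, hv, huv⟩ := exists_unit_re_pairing_gt μ p q hf1 hδ0
    ((min_le_left _ _).trans_lt (by norm_num))
  refine ⟨powLp μ p u, powLp μ q v, isDensity_powLp μ p hu, isDensity_powLp μ q hv, ?_⟩
  have hi := L1.integrable_coeFn f
  have hpi : Integrable (fun s => f s * pairing μ p q v (leftTranslate μ s u)) μ := by
    have := (pairing μ p q v).integrable_comp (integrable_smul_leftTranslate μ p f u)
    simpa only [map_smul, smul_eq_mul] using this
  have hpr : Integrable (fun s => ‖f s‖ * (pairing μ p q v (leftTranslate μ s u)).re) μ := by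
    refine hpi.re.congr ?_
    filter_upwards [hf.ae_eq_norm] with s hs
    rw [hs]
    simp
  have hval : ∫ s, ‖f s‖ * (pairing μ p q v (leftTranslate μ s u)).re ∂μ =
      (pairing μ p q v (lam μ p f u)).re := by
    rw [lam_apply, ← ContinuousLinearMap.integral_comp_comm _
      (integrable_smul_leftTranslate μ p f u)]
    simp only [map_smul, smul_eq_mul]
    have := integral_re (𝕜 := ℂ) hpi
    simp only [RCLike.re_to_complex] at this
    rw [← this]
    refine integral_congr_ae ?_
    filter_upwards [hf.ae_eq_norm] with s hs
    rw [hs]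
    simp
  have hfn : ∫ s, ‖f s‖ ∂μ = 1 := by rw [← L1.norm_eq_integral_norm, hf.norm_eq]
  rw [hf.re_integralSmul_orbitDist]
  calc ∫ s, ‖f s‖ * ‖leftTranslate μ s (powLp μ p u) - powLp μ q v‖ ∂μ
      ≤ ∫ s, ((c + 2 * η) * ‖f s‖ -
          c * (‖f s‖ * (pairing μ p q v (leftTranslate μ s u)).re)) ∂μ := by
        refine integral_mono (integrable_norm_mul_norm_leftTranslate_sub f _ _)
          ((hi.norm.const_mul _).sub (hpr.const_mul _)) fun s => ?_
        have := norm_powLp_sub_powLp_le μ p q hη0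
          ((norm_leftTranslate μ s u).trans hu) hv
        rw [← leftTranslate_powLp] at this
        refine (mul_le_mul_of_nonneg_left this (norm_nonneg (f s))).trans_eq ?_
        ring
    _ = (c + 2 * η) - c * (pairing μ p q v (lam μ p f u)).re := by
        rw [integral_sub (hi.norm.const_mul _) (hpr.const_mul _), integral_const_mul,
          integral_const_mul, hfn, hval, mul_one]
    _ ≤ c * δ + 2 * η := by nlinarith
    _ ≤ c * (ε / (2 * c)) + 2 * η := by
        gcongr
        exact min_le_right _ _
    _ = ε := by
        rw [hη]
        field_simp
        ring

/-- If all `λ_p(f)`, `f` a probability density, have norm one, then there are almost invariant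
probability densities. -/
theorem exists_isDensity_norm_leftTranslate_sub_le (p : ℝ≥0∞) [Fact (1 ≤ p)] [Fact (p ≠ ∞)]
    (q : ℝ≥0∞) [Fact (1 ≤ q)] [Fact (q ≠ ∞)] [p.HolderConjugate q]
    (h : ∀ f : Lp ℂ 1 μ, IsDensity μ f → 1 ≤ ‖lam μ p f‖) (S : Finset G) {ε : ℝ} (hε : 0 < ε) :
    ∃ g : Lp ℂ 1 μ, IsDensity μ g ∧ ∀ x ∈ S, ‖leftTranslate μ x g - g‖ ≤ ε := by
  classical
  obtain ⟨k, hk, -⟩ := exists_isDensity_of_mem_nhds μ (t := 1) univ_mem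
  -- Including the identity compares `k * g` itself with `u`, so that invariance follows from the
  -- triangle inequality through `u`.
  set S' := insert 1 S with hS'
  have hcard : (0 : ℝ) < S'.card := by
    exact_mod_cast Finset.card_pos.2 ⟨1, Finset.mem_insert_self 1 S⟩
  set w : ℝ := (S'.card : ℝ)⁻¹ with hw
  have hw0 : 0 < w := inv_pos.2 hcard
  set f : Lp ℂ 1 μ := ∑ x ∈ S', w • leftTranslate μ x k with hf
  have hfd : IsDensity μ f := convex_isDensity.sum_mem (fun x _ => hw0.le)
    (by rw [Finset.sum_const, nsmul_eq_mul, hw, mul_inv_cancel₀ hcard.ne'])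
    fun x _ => hk.translate x
  -- The average distance for `f` is a sum of nonnegative terms of weight `w`, so each translate of
  -- `k` contributes at most the total divided by `w`; hence the tolerance `w * (ε / 2)`.
  obtain ⟨g, u, hg, hu, hgu⟩ := exists_isDensity_orbitDist_le μ p q hfd (h f hfd)
    (ε := w * (ε / 2)) (by positivity)
  have hnear : ∀ x ∈ S', ‖leftTranslate μ x (lam μ 1 k g) - u‖ ≤ ε / 2 := by
    intro x hx
    rw [leftTranslate_lam]
    refine ((hk.translate x).norm_lam_sub_le g u).trans ?_
    set J := integralSmul μ (orbitDist μ g u) with hJ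
    have hJf : (J f).re = ∑ x ∈ S', w * (J (leftTranslate μ x k)).re := by
      rw [hf, _root_.map_sum, Complex.re_sum]
      refine Finset.sum_congr rfl fun x _ => ?_
      rw [map_real_smul J J.continuous, Complex.smul_re, smul_eq_mul]
    have hpos : ∀ x, 0 ≤ (J (leftTranslate μ x k)).re := fun x => by
      rw [hJ, (hk.translate x).re_integralSmul_orbitDist]
      exact integral_nonneg fun s => by positivity
    rw [hJf] at hgu
    have := (Finset.single_le_sum (f := fun x => w * (J (leftTranslate μ x k)).re)
      (fun x _ => mul_nonneg hw0.le (hpos x)) hx).trans hgu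
    exact le_of_mul_le_mul_left this hw0
  refine ⟨lam μ 1 k g, hk.convolve hg, fun x hx => ?_⟩
  have h1 := hnear 1 (Finset.mem_insert_self 1 S)
  rw [leftTranslate_one] at h1
  rw [← sub_sub_sub_cancel_right _ _ u]
  refine (norm_sub_le _ _).trans ?_
  linarith [hnear x (Finset.mem_insert_of_mem hx)]

end Reiter

/-! ### An invariant mean as a limit of almost invariant densities -/

section Limit
variable {G : Type*} [Group G] [TopologicalSpace G] [IsTopologicalGroup G]
  [LocallyCompactSpace G] [T2Space G] [MeasurableSpace G] [BorelSpace G]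
variable (μ : Measure G) [μ.IsHaarMeasure] [μ.Regular]

theorem ae_norm_le_norm_Linfty (φ : Lp ℝ ∞ μ) : ∀ᵐ x ∂μ, ‖φ x‖ ≤ ‖φ‖ := by
  filter_upwards [enorm_ae_le_eLpNormEssSup φ μ] with x hx
  rw [Lp.norm_def, eLpNorm_exponent_top, ← toReal_enorm]
  exact ENNReal.toReal_mono (by simpa using Lp.eLpNorm_ne_top φ) hx

theorem integrable_Linfty_mul (φ : Lp ℝ ∞ μ) {w : G → ℝ} (hw : Integrable w μ) :
    Integrable (fun x => φ x * w x) μ := by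
  refine Integrable.mono' (hw.norm.const_mul ‖φ‖)
    ((Lp.aestronglyMeasurable φ).mul hw.aestronglyMeasurable) ?_
  filter_upwards [ae_norm_le_norm_Linfty μ φ] with x hx
  rw [norm_mul]
  gcongr

/-- The functional `φ ↦ ∫ φ |h|` on `L^∞(G)`. -/
noncomputable def weightedMean (h : Lp ℂ 1 μ) : Lp ℝ ∞ μ →ₗ[ℝ] ℝ where
  toFun φ := ∫ x, φ x * ‖h x‖ ∂μ
  map_add' φ ψ := by
    have hi := (L1.integrable_coeFn h).norm
    rw [← integral_add (integrable_Linfty_mul μ φ hi) (integrable_Linfty_mul μ ψ hi)]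
    refine integral_congr_ae ?_
    filter_upwards [Lp.coeFn_add φ ψ] with x hx
    rw [hx, Pi.add_apply, add_mul]
  map_smul' c φ := by
    rw [RingHom.id_apply, smul_eq_mul, ← integral_const_mul]
    refine integral_congr_ae ?_
    filter_upwards [Lp.coeFn_smul c φ] with x hx
    rw [hx, Pi.smul_apply, smul_eq_mul, mul_assoc]

theorem weightedMean_apply (h : Lp ℂ 1 μ) (φ : Lp ℝ ∞ μ) :
    weightedMean μ h φ = ∫ x, φ x * ‖h x‖ ∂μ := rfl

theorem weightedMean_leftTranslate (h : Lp ℂ 1 μ) (φ : Lp ℝ ∞ μ) (s : G) :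
    weightedMean μ h (leftTranslate μ s φ) = weightedMean μ (leftTranslate μ s⁻¹ h) φ := by
  rw [weightedMean_apply, weightedMean_apply,
    ← integral_mul_left_eq_self (fun x => leftTranslate μ s φ x * ‖h x‖) s]
  refine integral_congr_ae ?_
  filter_upwards [leftTranslate_ae_eq μ s⁻¹ h,
    (measurePreserving_mul_left μ s).quasiMeasurePreserving.ae (leftTranslate_ae_eq μ s φ)]
    with x h1 h2
  rw [h1, h2, inv_mul_cancel_left, inv_inv]

theorem abs_weightedMean_sub_le (h k : Lp ℂ 1 μ) (φ : Lp ℝ ∞ μ) :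
    |weightedMean μ h φ - weightedMean μ k φ| ≤ ‖φ‖ * ‖h - k‖ := by
  have hi := (L1.integrable_coeFn h).norm
  have ki := (L1.integrable_coeFn k).norm
  rw [weightedMean_apply, weightedMean_apply, ← integral_sub (integrable_Linfty_mul μ φ hi)
    (integrable_Linfty_mul μ φ ki), L1.norm_eq_integral_norm, ← integral_const_mul,
    ← Real.norm_eq_abs]
  refine norm_integral_le_of_norm_le ((L1.integrable_coeFn (h - k)).norm.const_mul _) ?_
  filter_upwards [ae_norm_le_norm_Linfty μ φ, Lp.coeFn_sub h k] with x h1 h2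
  rw [← mul_sub, norm_mul, h2, Pi.sub_apply]
  gcongr
  exact abs_norm_sub_norm_le _ _

/-- Integration against densities gives contractive functionals on `L^∞(G)`. By Tychonoff they
converge pointwise along an ultrafilter finer than the order on pairs (finite set, precision), and
linearity, positivity, normalisation and invariance pass to the limit. -/
theorem isAmenable_of_isDensity
    (hR : ∀ (S : Finset G) (ε : ℝ), 0 < ε →
      ∃ g : Lp ℂ 1 μ, IsDensity μ g ∧ ∀ x ∈ S, ‖leftTranslate μ x g - g‖ ≤ ε) :
    IsAmenable μ := by
  classical
  choose! g hg hgS using fun (i : Finset G × ℕ) => hR i.1 (1 / ((i.2 : ℝ) + 1)) (by positivity)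
  let U : Ultrafilter (Finset G × ℕ) := Ultrafilter.of atTop
  have hU : (U : Filter (Finset G × ℕ)) ≤ atTop := Ultrafilter.of_le atTop
  let M : Finset G × ℕ → Lp ℝ ∞ μ → ℝ := fun i => weightedMean μ (g i)
  have hMb : ∀ i, M i ∈ Set.pi univ fun φ : Lp ℝ ∞ μ => Icc (-‖φ‖) ‖φ‖ := fun i φ _ => by
    have := abs_weightedMean_sub_le μ (g i) 0 φ
    have h0 : weightedMean μ 0 φ = 0 := by
      rw [weightedMean_apply]
      refine integral_eq_zero_of_ae ?_
      filter_upwards [Lp.coeFn_zero ℂ 1 μ] with x hx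
      rw [hx]
      simp
    rw [h0, sub_zero, sub_zero, (hg i).norm_eq, mul_one] at this
    exact abs_le.1 this
  obtain ⟨m, -, hm⟩ := (isCompact_univ_pi fun φ : Lp ℝ ∞ μ =>
    isCompact_Icc (a := -‖φ‖) (b := ‖φ‖)).ultrafilter_le_nhds (U.map M)
      (tendsto_principal.2 (Eventually.of_forall hMb))
  have hlim : ∀ φ, Tendsto (fun i => weightedMean μ (g i) φ) U (𝓝 (m φ)) :=
    tendsto_pi_nhds.1 hm
  have hadd : ∀ φ ψ, m (φ + ψ) = m φ + m ψ := fun φ ψ => by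
    refine tendsto_nhds_unique (hlim (φ + ψ)) ?_
    simp only [map_add]
    exact (hlim φ).add (hlim ψ)
  have hsmul : ∀ (c : ℝ) φ, m (c • φ) = c • m φ := fun c φ => by
    refine tendsto_nhds_unique (hlim (c • φ)) ?_
    simp only [map_smul]
    exact (hlim φ).const_smul c
  refine ⟨{ toFun := m, map_add' := hadd, map_smul' := hsmul }, fun φ hφ => ?_, ?_, fun s φ => ?_⟩
  · refine ge_of_tendsto (hlim φ) (Eventually.of_forall fun i => ?_)
    rw [weightedMean_apply]
    refine integral_nonneg_of_ae ?_
    filter_upwards [(Lp.coeFn_nonneg φ).2 hφ] with x hx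
    exact mul_nonneg hx (norm_nonneg _)
  · refine tendsto_nhds_unique (hlim _) (tendsto_const_nhds.congr fun i => ?_)
    rw [weightedMean_apply]
    refine (hg i).norm_eq.symm.trans ?_
    rw [L1.norm_eq_integral_norm]
    refine integral_congr_ae ?_
    filter_upwards [(memLp_top_const (μ := μ) (1 : ℝ)).coeFn_toLp] with x hx
    rw [hx, one_mul]
  · show m (leftTranslate μ s φ) = m φ
    rw [← sub_eq_zero]
    refine tendsto_nhds_unique ((hlim (leftTranslate μ s φ)).sub (hlim φ)) ?_
    have h0 : Tendsto (fun i : Finset G × ℕ => ‖φ‖ * (1 / ((i.2 : ℝ) + 1))) U (𝓝 0) := by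
      have h1 : Tendsto (fun i : Finset G × ℕ => i.2) atTop atTop := by
        rw [← prod_atTop_atTop_eq]
        exact tendsto_snd
      simpa using ((tendsto_one_div_add_atTop_nhds_zero_nat (𝕜 := ℝ)).comp
        (h1.mono_left hU)).const_mul ‖φ‖
    refine squeeze_zero_norm' ?_ h0
    -- Translating `φ` by `s` amounts to translating the density by `s⁻¹`, so it is `s⁻¹` that must
    -- eventually belong to the finite set.
    have hev : ∀ᶠ i in (U : Filter (Finset G × ℕ)), ({s⁻¹}, 0) ≤ i := hU (eventually_ge_atTop _)
    filter_upwards [hev] with i hi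
    rw [weightedMean_leftTranslate]
    refine (abs_weightedMean_sub_le μ _ _ φ).trans ?_
    gcongr
    exact hgS i s⁻¹ (hi.1 (Finset.mem_singleton_self _))

theorem isAmenable_of_starAlgHom (p : ℝ≥0∞) [Fact (1 < p)] [Fact (p < ∞)]
    (π : PFStar μ p →⋆ₙₐ[ℂ] ℂ) (hπ : ∀ f : Lp ℂ 1 μ, π (PFStar.of μ p f) = ∫ s, f s ∂μ) :
    IsAmenable μ := by
  refine isAmenable_of_isDensity μ fun S ε hε =>
    exists_isDensity_norm_leftTranslate_sub_le μ p p.conjExponent (fun f hf => ?_) S hε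
  refine one_le_norm_lam_of_isDensity μ p (fun f => ?_) hf
  rw [totalIntegral_apply, ← hπ]
  refine (norm_starAlgHom_apply_le μ p π _).trans_eq ?_
  exact UniformSpace.Completion.norm_coe (E := L1PF μ p) f

end Limit
end PseudoFun

/-- For a locally compact group `G` with left Haar measure `μ` and `1 < p < ∞`: `G` is amenable if
and only if the integrated trivial representation `f ↦ ∫ f` of `L¹(G)` extends to a
`*`-representation of `PF_p^*(G)` on the Hilbert space `ℂ` (whose bounded operators are `ℂ`). -/
theorem mainTheorem8 {G : Type*} [Group G] [TopologicalSpace G] [IsTopologicalGroup G]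
    [LocallyCompactSpace G] [T2Space G] [MeasurableSpace G] [BorelSpace G]
    (μ : Measure G) [μ.IsHaarMeasure] [μ.Regular] (p : ℝ≥0∞) [Fact (1 < p)] [Fact (p < ∞)] :
    PseudoFun.IsAmenable μ ↔
      ∃ π : PseudoFun.PFStar μ p →⋆ₙₐ[ℂ] ℂ,
        ∀ f : Lp ℂ 1 μ, π (PseudoFun.PFStar.of μ p f) = ∫ s, f s ∂μ :=
  ⟨fun h => h.exists_starAlgHom μ p,
    fun ⟨π, hπ⟩ => PseudoFun.isAmenable_of_starAlgHom μ p π hπ⟩
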